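/- Let $s\in\{\tfrac12,1,\tfrac32,\dots\}$, let $n\ge1$ and $0\le k\le 2sn$ be integers, put $d=2sn+1$, and let $|D^{(s)}_{n,k}\rangle$ be the normalization of $(\mathbb S^-)^k|0\rangle^{\otimes n}$, where $\mathbb S^-$ is the total spin-lowering operator of $n$ spin-$s$ qudits with levels $|0\rangle,\dots,|2s\rangle$, $S^-|m\rangle=\sqrt{(m+1)(2s-m)}\,|m+1\rangle$. Let $\mathbb K=\sum_{i=1}^n \mathbb k_i$, where $\mathbb k=\sum_{m=0}^{2s} m\,|m\rangle\langle m|$, let $C\mathcal U\,|y\rangle|x\rangle=(e^{2\pi i x\mathbb K/d}|y\rangle)|x\rangle$ for $0\le x<d$, let $H_d|x\rangle=d^{-1/2}\sum_{y=0}^{d-1}e^{2\pi i xy/d}|y\rangle$, and, with $p=k/(2sn)$ and $0^0=1$, let $$|\psi(s,p)\rangle=\sum_{m=0}^{2s}\sqrt p^{\,m}\sqrt{1-p}^{\,2s-m}\sqrt{\tbinom{2s}{m}}\,|m\rangle .$$ Consider circuits on $n$ system qudits of dimension $2s+1$ and ancilla qudits of dimension $d$. Such a circuit consists of layers of arbitrary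 unitary gates on disjoint sets of at most two qudits, and of rounds of simultaneous single-qudit measurements in the computational basis. Everything that follows a measurement may depend on the outcomes obtained so far. The depth is the largest number of layers and measurement rounds over all sequences of outcomes. There are universal constants $c_1,c_2,c_3$, independent of $s,n,k$, such that for all $s,n,k$ as above the state $|D^{(s)}_{n,k}\rangle$ is prepared as follows by a circuit of depth at most $c_1$ with at most $c_2n$ ancillas, all of dimension $2sn+1$, started with every qudit in $|0\rangle$: 1. A single-qudit unitary $V$ with $V|0\rangle=|\psi(s,p)\rangle$ is applied to every system qudit, and $H_d$ to one of the ancillas, the control. 2. $C\mathcal U$ is applied to the system and the control. It is implemented exactly and deterministically by a circuit of the above kind that may use the other ancillas, which start in $|0\rangle$ and are returned in $|0\rangle$. 3. $H_d^\dagger$ is applied to the control, and the control is measured. The run succeeds if the outcome is $k$. The success probability is $$P(k)=\binom{2sn}{k}p^k(1-p)^{2sn-k}>0,$$ and on success the state of the system is exactly $|D^{(s)}_{n,k}\rangle$, with the control in $|k\rangle$ and the other ancillas in $|0\rangle$. The expected number of independent repetitions up to and including the first success is at most $c_3\sqrt{sn}$. -/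

import Mathlib

open scoped ENNReal Matrix

namespace QuditDicke

/-! ### Registers of qudits, operators and kets -/

/-- Computational basis labels of a register whose wire `i` is a qudit of dimension `dim i`. -/
abbrev Config {ι : Type} (dim : ι → ℕ) : Type := (i : ι) → Fin (dim i)

section Register

variable {ι : Type} [DecidableEq ι] {dim : ι → ℕ}

/-- The operator `1 ⊗ ⋯ ⊗ M ⊗ ⋯ ⊗ 1`, where `M` acts on the wires in `S`. -/
def embed [Fintype ι] (S : Finset ι)
    (M : Matrix ((i : S) → Fin (dim i)) ((i : S) → Fin (dim i)) ℂ) :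
    Matrix (Config dim) (Config dim) ℂ :=
  fun x y => if ∀ i, i ∉ S → x i = y i then M (fun i => x i) (fun i => y i) else 0

/-- The operator on the wires `{i}` given by an operator on the single qudit `i`. -/
def singleOp (i : ι) (M : Matrix (Fin (dim i)) (Fin (dim i)) ℂ) :
    Matrix ((j : ({i} : Finset ι)) → Fin (dim j)) ((j : ({i} : Finset ι)) → Fin (dim j)) ℂ :=
  M.submatrix (fun x => x ⟨i, Finset.mem_singleton_self i⟩)
    (fun x => x ⟨i, Finset.mem_singleton_self i⟩)

/-- The operator `1 ⊗ ⋯ ⊗ M ⊗ ⋯ ⊗ 1`, where `M` acts on the single wire `i`. -/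
def onWire [Fintype ι] (i : ι) (M : Matrix (Fin (dim i)) (Fin (dim i)) ℂ) :
    Matrix (Config dim) (Config dim) ℂ :=
  embed {i} (singleOp i M)

/-- The operator `|v⟩⟨v|`. -/
def proj {X : Type} (v : X → ℂ) : Matrix X X ℂ := Matrix.vecMulVec v (star v)

theorem singleOp_mem_unitary (i : ι) {M : Matrix (Fin (dim i)) (Fin (dim i)) ℂ}
    (hM : M ∈ Matrix.unitaryGroup (Fin (dim i)) ℂ) :
    singleOp i M ∈ Matrix.unitaryGroup ((j : ({i} : Finset ι)) → Fin (dim j)) ℂ := by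
  let e : ((j : ({i} : Finset ι)) → Fin (dim j)) ≃ Fin (dim i) :=
    { toFun := fun x => x ⟨i, Finset.mem_singleton_self i⟩
      invFun := fun a j => Fin.cast (by rw [Finset.mem_singleton.1 j.2]) a
      left_inv := by
        intro x
        funext ⟨j, hj⟩
        obtain rfl := Finset.mem_singleton.1 hj
        rfl
      right_inv := fun a => rfl }
  have h : singleOp i M = M.submatrix e e := rfl
  rw [Matrix.mem_unitaryGroup_iff] at hM ⊢
  rw [h, Matrix.star_eq_conjTranspose, Matrix.conjTranspose_submatrix,
    Matrix.submatrix_mul_equiv, ← Matrix.star_eq_conjTranspose, hM, Matrix.submatrix_one_equiv]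

end Register

/-! ### Circuits with mid-circuit measurement and feedforward -/

/-- A gate: an arbitrary unitary acting on at most two qudits. -/
structure Gate {ι : Type} [Fintype ι] [DecidableEq ι] (dim : ι → ℕ) where
  support : Finset ι
  card_le : support.card ≤ 2
  mat : Matrix.unitaryGroup ((i : support) → Fin (dim i)) ℂ

/-- A layer: gates on pairwise disjoint sets of wires, executed in parallel. -/
structure Layer {ι : Type} [Fintype ι] [DecidableEq ι] (dim : ι → ℕ) where
  gates : List (Gate dim)
  disjoint : gates.Pairwise fun g h => Disjoint g.support h.support

/-- A circuit with mid-circuit measurement and classical feedforward. It stops with a classical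
output, or applies a layer of gates and continues, or measures a set of wires in the computational
basis and continues in a way that may depend on the outcomes (and so on all earlier outcomes). -/
inductive AdaptiveCircuit {ι : Type} [Fintype ι] [DecidableEq ι] (dim : ι → ℕ) (β : Type) : Type
  | done (b : β) : AdaptiveCircuit dim β
  | layer (L : Layer dim) (next : AdaptiveCircuit dim β) : AdaptiveCircuit dim β
  | measure (S : Finset ι) (next : ((i : S) → Fin (dim i)) → AdaptiveCircuit dim β) :
      AdaptiveCircuit dim β

section Circuit

variable {ι : Type} [Fintype ι] [DecidableEq ι] {dim : ι → ℕ}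

/-- The gate that applies `u` to the single wire `i`. -/
def Gate.single (i : ι) (u : Matrix.unitaryGroup (Fin (dim i)) ℂ) : Gate dim where
  support := {i}
  card_le := by simp
  mat := ⟨singleOp i u.1, singleOp_mem_unitary i u.2⟩

/-- The unitary operator on the whole register that a gate performs. -/
def Gate.toMatrix (g : Gate dim) : Matrix (Config dim) (Config dim) ℂ :=
  embed g.support g.mat.1

/-- The layer that applies `u i` to the wire `i`, for every wire. -/
noncomputable def Layer.ofSingle (u : (i : ι) → Matrix.unitaryGroup (Fin (dim i)) ℂ) :
    Layer dim where
  gates := (Finset.univ : Finset ι).toList.map fun i => Gate.single i (u i)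
  disjoint := by
    rw [List.pairwise_map]
    refine (Finset.nodup_toList _).imp ?_
    intro i j hij
    simpa [Gate.single] using hij

/-- The unitary operator on the whole register that a layer performs
(its gates commute, since their supports are disjoint). -/
noncomputable def Layer.toMatrix (L : Layer dim) : Matrix (Config dim) (Config dim) ℂ :=
  (L.gates.map Gate.toMatrix).prod

/-- The projector onto the outcome `y` of a measurement of the wires in `S`. -/
def outcomeProj (S : Finset ι) (y : (i : S) → Fin (dim i)) :
    Matrix (Config dim) (Config dim) ℂ :=
  Matrix.diagonal fun x => if ∀ i : S, x i = y i then 1 else 0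

namespace AdaptiveCircuit

variable {α β : Type}

/-- Worst-case depth over all measurement outcomes: each layer of gates and each round of
simultaneous single-qudit measurements counts one. -/
def depth : AdaptiveCircuit dim β → ℕ
  | done _ => 0
  | layer _ next => 1 + next.depth
  | measure _ next => 1 + Finset.univ.sup fun y => (next y).depth

/-- Run a circuit and continue with the circuit selected by its classical output. -/
def bind : AdaptiveCircuit dim α → (α → AdaptiveCircuit dim β) → AdaptiveCircuit dim β
  | done a, f => f a
  | layer L next, f => layer L (next.bind f)
  | measure S next, f => measure S fun y => (next y).bind f

/-- The quantum instrument of a circuit: `c.run b ρ` is the unnormalized state of the register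
after running `c` on `ρ`, restricted to the runs with classical output `b`. Its trace is the
probability of the output `b`. -/
noncomputable def run [DecidableEq β] : AdaptiveCircuit dim β → β →
    Matrix (Config dim) (Config dim) ℂ → Matrix (Config dim) (Config dim) ℂ
  | done b', b, ρ => if b' = b then ρ else 0
  | layer L next, b, ρ => next.run b (L.toMatrix * ρ * L.toMatrixᴴ)
  | measure S next, b, ρ =>
      ∑ y : (i : S) → Fin (dim i), (next y).run b (outcomeProj S y * ρ * (outcomeProj S y)ᴴ)

/-- The probability that a circuit, run on the state `ρ`, accepts (outputs `true`). -/
noncomputable def acceptProb (c : AdaptiveCircuit dim Bool)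
    (ρ : Matrix (Config dim) (Config dim) ℂ) : ℝ :=
  (c.run true ρ).trace.re

end AdaptiveCircuit

end Circuit

/-- The expected number of independent repetitions of an experiment with success probability `q`
up to and including the first success: the sum over `t` of the probability that the first `t`
repetitions all fail. -/
noncomputable def expectedRepetitions (q : ℝ) : ℝ≥0∞ := ∑' t : ℕ, ENNReal.ofReal ((1 - q) ^ t)

/-! ### Spin-`s` Dicke states; `a` stands for the positive integer `2 s` -/

/-- Basis labels of a system of `n` qudits with `a + 1 = 2 s + 1` levels. -/
abbrev Sys (a n : ℕ) : Type := Config (fun _ : Fin n => a + 1)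

/-- The spin-`s` lowering operator, `S⁻ |m⟩ = √((m + 1) (2 s - m)) |m + 1⟩`, where `|m⟩` is the
state with `S^z = s - m`. -/
noncomputable def spinLower (a : ℕ) : Matrix (Fin (a + 1)) (Fin (a + 1)) ℂ :=
  fun x y => if (x : ℕ) = y + 1 then (Real.sqrt (((y : ℝ) + 1) * ((a : ℝ) - y)) : ℂ) else 0

/-- The total lowering operator of `n` spins. -/
noncomputable def totalLower (a n : ℕ) : Matrix (Sys a n) (Sys a n) ℂ :=
  ∑ i : Fin n, onWire (dim := fun _ : Fin n => a + 1) i (spinLower a)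

/-- The unnormalized Dicke state `(S⁻)^k |0⟩^{⊗ n}`. -/
noncomputable def dickeUnnormalized (a n k : ℕ) : Sys a n → ℂ :=
  (totalLower a n ^ k) *ᵥ Pi.single (fun _ => 0) 1

/-- The spin-`s` Dicke state: the normalization of `(S⁻)^k |0⟩^{⊗ n}`. -/
noncomputable def dicke (a n k : ℕ) : Sys a n → ℂ :=
  ((Real.sqrt (∑ x, ‖dickeUnnormalized a n k x‖ ^ 2) : ℝ) : ℂ)⁻¹ • dickeUnnormalized a n k

/-- The one-qudit state `|ψ(s,p)⟩ = ∑ m, √p ^ m √(1 - p) ^ (2 s - m) √(2 s choose m) |m⟩`. -/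
noncomputable def psi (a : ℕ) (p : ℝ) : Fin (a + 1) → ℂ :=
  fun m => ((Real.sqrt p ^ (m : ℕ) * Real.sqrt (1 - p) ^ (a - (m : ℕ))
    * Real.sqrt (a.choose m) : ℝ) : ℂ)

/-- The operator `K = ∑ i, k_i`, where `k = ∑ m, m |m⟩⟨m|`. -/
noncomputable def opK (a n : ℕ) : Matrix (Sys a n) (Sys a n) ℂ :=
  ∑ i : Fin n, onWire (dim := fun _ : Fin n => a + 1) i
    (Matrix.diagonal fun m : Fin (a + 1) => ((m : ℕ) : ℂ))

/-- `𝒰(x) = exp(2 π i x K / d)` with `d = 2 s n + 1`. -/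
noncomputable def opU (a n : ℕ) (x : Fin (a * n + 1)) : Matrix (Sys a n) (Sys a n) ℂ :=
  NormedSpace.exp
    ((2 * Real.pi * Complex.I * ((x : ℕ) : ℂ) / ((a * n + 1 : ℕ) : ℂ)) • opK a n)

/-- The controlled gate `|y⟩|x⟩ ↦ (𝒰(x)|y⟩)|x⟩`. -/
noncomputable def controlledU (a n : ℕ) :
    Matrix (Sys a n × Fin (a * n + 1)) (Sys a n × Fin (a * n + 1)) ℂ :=
  fun z w => if z.2 = w.2 then opU a n w.2 z.1 w.1 else 0

/-- The generalized Hadamard gate `H_d |x⟩ = d^{-1/2} ∑ y, exp(2 π i x y / d) |y⟩`. -/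
noncomputable def hadamard (d : ℕ) : Matrix (Fin d) (Fin d) ℂ :=
  fun y x => ((Real.sqrt d : ℝ) : ℂ)⁻¹ *
    Complex.exp (2 * Real.pi * Complex.I * ((x : ℕ) : ℂ) * ((y : ℕ) : ℂ) / (d : ℂ))

theorem hadamard_mem_unitary (d : ℕ) : hadamard d ∈ Matrix.unitaryGroup (Fin d) ℂ := by
  rcases Nat.eq_zero_or_pos d with rfl | hd
  · rw [Matrix.mem_unitaryGroup_iff]
    exact Subsingleton.elim _ _
  have hd0 : d ≠ 0 := hd.ne'
  have hζ := Complex.isPrimitiveRoot_exp d hd0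
  set ζ : ℂ := Complex.exp (2 * Real.pi * Complex.I / d) with hζdef
  have hζ0 : ζ ≠ 0 := Complex.exp_ne_zero _
  have hnorm : ‖ζ‖ = 1 := hζ.norm'_eq_one hd0
  have hentry : ∀ y x : Fin d, hadamard d y x =
      ((Real.sqrt d : ℝ) : ℂ)⁻¹ * (ζ ^ (y : ℕ)) ^ (x : ℕ) := by
    intro y x
    rw [hadamard, hζdef, ← Complex.exp_nat_mul, ← Complex.exp_nat_mul]
    congr 2
    ring
  have hstar : star ζ = ζ⁻¹ := by
    rw [Complex.star_def, Complex.inv_eq_conj hnorm]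
  have hsq : ((Real.sqrt d : ℝ) : ℂ)⁻¹ * ((Real.sqrt d : ℝ) : ℂ)⁻¹ = (d : ℂ)⁻¹ := by
    rw [← mul_inv, ← Complex.ofReal_mul, Real.mul_self_sqrt (Nat.cast_nonneg d)]
    simp
  have hdC : (d : ℂ) ≠ 0 := Nat.cast_ne_zero.2 hd0
  rw [Matrix.mem_unitaryGroup_iff]
  ext y z
  have hsum : (hadamard d * star (hadamard d)) y z =
      (d : ℂ)⁻¹ * ∑ x ∈ Finset.range d, (ζ ^ (y : ℕ) * (ζ ^ (z : ℕ))⁻¹) ^ x := by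
    rw [Matrix.mul_apply, ← Fin.sum_univ_eq_sum_range, Finset.mul_sum]
    refine Finset.sum_congr rfl fun x _ => ?_
    rw [Matrix.star_apply, hentry, hentry, star_mul', star_pow, star_pow, hstar, star_inv₀,
      Complex.star_def, Complex.conj_ofReal, ← hsq, mul_pow, inv_pow]
    ring
  rw [hsum]
  by_cases h : y = z
  · subst h
    rw [mul_inv_cancel₀ (pow_ne_zero _ hζ0), Matrix.one_apply_eq]
    simp [hdC]
  · rw [Matrix.one_apply_ne h]
    have hω1 : ζ ^ (y : ℕ) * (ζ ^ (z : ℕ))⁻¹ - 1 ≠ 0 := by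
      intro h0
      have h1 : ζ ^ (y : ℕ) = ζ ^ (z : ℕ) := by
        have := sub_eq_zero.1 h0
        rwa [mul_inv_eq_one₀ (pow_ne_zero _ hζ0)] at this
      exact h (Fin.ext (hζ.pow_inj y.2 z.2 h1))
    have hωd : (ζ ^ (y : ℕ) * (ζ ^ (z : ℕ))⁻¹) ^ d = 1 := by
      rw [mul_pow, inv_pow, ← pow_mul, ← pow_mul, mul_comm _ d, mul_comm _ d, pow_mul, pow_mul,
        hζ.pow_eq_one]
      simp
    have := mul_geom_sum (ζ ^ (y : ℕ) * (ζ ^ (z : ℕ))⁻¹) d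
    rw [hωd, sub_self] at this
    rw [(mul_eq_zero.1 this).resolve_left hω1, mul_zero]

/-- The generalized Hadamard gate as a unitary. -/
noncomputable def hadamardU (d : ℕ) : Matrix.unitaryGroup (Fin d) ℂ :=
  ⟨hadamard d, hadamard_mem_unitary d⟩

/-! ### The Hadamard test -/

/-- Dimensions of the wires: `n` system qudits of dimension `a + 1 = 2 s + 1`, and `r + 1` ancilla
qudits of dimension `a * n + 1 = 2 s n + 1`. The ancilla `0` is the control of the Hadamard test;
the other `r` are additional. -/
abbrev wireDim (a n r : ℕ) : Fin n ⊕ Fin (r + 1) → ℕ :=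
  Sum.elim (fun _ => a + 1) (fun _ => a * n + 1)

section Test

variable {a n r : ℕ}

/-- System part of a basis label. -/
def sysPart (x : Config (wireDim a n r)) : Sys a n := fun i => x (Sum.inl i)

/-- Control part of a basis label. -/
def ctrlPart (x : Config (wireDim a n r)) : Fin (a * n + 1) := x (Sum.inr 0)

/-- Part of a basis label on the additional ancillas. -/
def ancPart (x : Config (wireDim a n r)) : Fin r → Fin (a * n + 1) := fun j => x (Sum.inr j.succ)

/-- `ρ ⊗ |0⟩⟨0|^{⊗ r}`, for an operator `ρ` on the system and the control. -/
def withAncillas (ρ : Matrix (Sys a n × Fin (a * n + 1)) (Sys a n × Fin (a * n + 1)) ℂ) :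
    Matrix (Config (wireDim a n r)) (Config (wireDim a n r)) ℂ :=
  fun x y => if ancPart x = 0 ∧ ancPart y = 0 then
    ρ (sysPart x, ctrlPart x) (sysPart y, ctrlPart y) else 0

/-- The ket `|φ⟩ |x⟩` of the system and the control. -/
def ketWith (φ : Sys a n → ℂ) (x : Fin (a * n + 1)) : Sys a n × Fin (a * n + 1) → ℂ :=
  fun z => φ z.1 * if z.2 = x then 1 else 0

/-- All wires in the state `|0⟩`. -/
def initialState : Matrix (Config (wireDim a n r)) (Config (wireDim a n r)) ℂ :=
  withAncillas (proj (ketWith (Pi.single (fun _ => 0) 1) 0))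

/-- The circuit `W` implements the gate `G` on the system and the control exactly and
deterministically, borrowing the additional ancillas in the state `|0⟩` and returning them so. -/
def Implements (W : AdaptiveCircuit (wireDim a n r) Unit)
    (G : Matrix (Sys a n × Fin (a * n + 1)) (Sys a n × Fin (a * n + 1)) ℂ) : Prop :=
  ∀ ρ : Matrix (Sys a n × Fin (a * n + 1)) (Sys a n × Fin (a * n + 1)) ℂ,
    W.run () (withAncillas ρ) = withAncillas (G * ρ * Gᴴ)

/-- The layer that applies `V` to every system qudit and `H` to the control. -/
noncomputable def sideLayer (V : Matrix.unitaryGroup (Fin (a + 1)) ℂ)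
    (H : Matrix.unitaryGroup (Fin (a * n + 1)) ℂ) : Layer (wireDim a n r) :=
  Layer.ofSingle fun i => match i with
    | Sum.inl _ => V
    | Sum.inr j => if j = 0 then H else 1

/-- The qudit Hadamard test: apply `V` to every system qudit and `H_d` to the control, run `W`
(in the role of the controlled gate), apply `H_d†` to the control, measure the control, and accept
if and only if the outcome is `k`. -/
noncomputable def hadamardTest (V : Matrix.unitaryGroup (Fin (a + 1)) ℂ)
    (W : AdaptiveCircuit (wireDim a n r) Unit) (k : ℕ) : AdaptiveCircuit (wireDim a n r) Bool :=
  .layer (sideLayer V (hadamardU (a * n + 1))) <|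
    W.bind fun _ =>
      .layer (sideLayer 1 (star (hadamardU (a * n + 1)))) <|
        .measure {Sum.inr 0} fun y =>
          .done (decide (((y ⟨Sum.inr 0, Finset.mem_singleton_self _⟩ :
            Fin (a * n + 1)) : ℕ) = k))

end Test

end QuditDicke

open QuditDicke

/-! Write `a` for 2s, N = a n, d = N + 1, and χ for the standard additive character of ℤ/d. Let the
level of a basis label m be ∑ m_i.

The test works because |ψ⟩^{⊗n} has amplitude √p^ℓ √(1-p)^(N-ℓ) ∏ √(a choose m_i) at a label m of
level ℓ, while the Dicke state of index k is proportional to ∏ √(a choose m_i) on the labels of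
level k (`dickeUnnormalized_apply`, by induction on k). So the product state is a superposition of
Dicke states with binomial weights, and it remains to measure the level. The controlled gate is
diagonal with phase χ(c · level m), so between H_d and H_d† it writes the level into the control by
Fourier inversion; levels are at most N < d, so nothing wraps around (`testKet_apply`). For p = k/N
the weight of level k is at least 1/(e² √N) by Stirling (`one_le_modeProb_mul`), and the waiting
time is geometric.

Constant depth comes from χ(c ∑ m_i) = ∏ χ(c m_i): with n copies of c, all two-qudit phases act in
parallel. The copies come from a cluster state on 2n ancillas. Both the n copy wires and the n
parity wires start in uniform superposition; phases couple each parity wire to two neighbouring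
copies, and a Fourier measurement of it with outcome o forces the difference of these copies to be
o. Hence each copy is c plus a known offset. After the phases with the system, a Fourier measurement
erases the copies. Since all these phases are diagonal, one measurement round at the end serves both
purposes, and the byproducts are diagonal gates on single qudits (`fanoutAmp_eq`,
`correctionPhase_mul_fanoutAmp`). Every branch equals the controlled gate up to a scalar of modulus
d^(-n), and there are d^(2n) branches, so the sum of the branches is exactly the gate
(`fanoutCircuit_implements`). -/

namespace QuditDicke

/-! ### Matrix entries of layers; linearity and composition of circuits -/

section Register

variable {ι : Type} [Fintype ι] [DecidableEq ι] {dim : ι → ℕ}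

theorem embed_diagonal (S : Finset ι) (f : ((i : S) → Fin (dim i)) → ℂ) :
    embed S (Matrix.diagonal f) =
      Matrix.diagonal fun x : Config dim => f fun i => x i := by
  ext x y
  by_cases hxy : x = y
  · subst hxy
    simp [embed]
  · rw [Matrix.diagonal_apply_ne _ hxy, embed]
    split_ifs with h
    · refine Matrix.diagonal_apply_ne _ fun h' => hxy ?_
      funext i
      by_cases hi : i ∈ S
      · exact congrFun h' ⟨i, hi⟩
      · exact h i hi
    · rfl

theorem onWire_diagonal (i : ι) (f : Fin (dim i) → ℂ) :
    onWire i (Matrix.diagonal f) = Matrix.diagonal fun x : Config dim => f (x i) := by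
  have h : singleOp (dim := dim) i (Matrix.diagonal f) =
      Matrix.diagonal fun x => f (x ⟨i, Finset.mem_singleton_self i⟩) := by
    ext x y
    by_cases hxy : x = y
    · subst hxy
      simp [singleOp]
    · rw [Matrix.diagonal_apply_ne _ hxy]
      refine Matrix.diagonal_apply_ne _ fun h' => hxy ?_
      funext ⟨j, hj⟩
      obtain rfl := Finset.mem_singleton.1 hj
      exact h'
  rw [onWire, h, embed_diagonal]

theorem onWire_apply (i : ι) (M : Matrix (Fin (dim i)) (Fin (dim i)) ℂ) (x y : Config dim) :
    onWire i M x y = if ∀ j, j ≠ i → x j = y j then M (x i) (y i) else 0 := by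
  simp [onWire, embed, singleOp]

/-- The row `x` of a one-wire operator is supported on labels that differ from `x` at most at `i`,
so the matrix product collapses to a sum over one qudit. -/
theorem onWire_mul_apply {R : Type*} (i : ι) (M : Matrix (Fin (dim i)) (Fin (dim i)) ℂ)
    (N : Matrix (Config dim) R ℂ) (x : Config dim) (z : R) :
    (onWire i M * N) x z = ∑ c, M (x i) c * N (Function.update x i c) z := by
  rw [Matrix.mul_apply]
  symm
  refine Finset.sum_of_injOn (fun c => Function.update x i c)
    (Function.update_injective x i).injOn (by simp) ?_ ?_
  · intro y _ hy
    rw [onWire_apply, if_neg, zero_mul]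
    intro h
    refine hy ⟨y i, by simp, ?_⟩
    funext j
    by_cases hj : j = i
    · subst hj; simp
    · simp [hj, h j hj]
  · intro c _
    rw [onWire_apply, if_pos]
    · simp
    · intro j hj
      simp [hj]

/-- Stated for sublists so that induction applies; the agreement condition off `l` becomes vacuous
when `l` lists all wires. -/
theorem list_prod_onWire_apply (u : (i : ι) → Matrix (Fin (dim i)) (Fin (dim i)) ℂ)
    (l : List ι) (hl : l.Nodup) (x y : Config dim) :
    (l.map fun i => onWire i (u i)).prod x y =
      if ∀ i, i ∉ l → x i = y i then ∏ i ∈ l.toFinset, u i (x i) (y i) else 0 := by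
  induction l generalizing x with
  | nil =>
    simp only [List.map_nil, List.prod_nil, List.not_mem_nil, not_false_eq_true, forall_const,
      List.toFinset_nil, Finset.prod_empty, Matrix.one_apply]
    simp only [funext_iff]
  | cons i l ih =>
    obtain ⟨hi, hl⟩ := List.nodup_cons.1 hl
    rw [List.map_cons, List.prod_cons, onWire_mul_apply]
    simp only [ih hl]
    -- The tail does not touch wire `i`, so the intermediate label must already equal `y` there.
    rw [Finset.sum_eq_single (y i)]
    · have hi' : i ∉ l.toFinset := by simpa using hi
      rw [List.toFinset_cons, Finset.prod_insert hi']
      have hcond : (∀ j, j ∉ l → Function.update x i (y i) j = y j) ↔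
          ∀ j, j ∉ i :: l → x j = y j := by
        refine ⟨fun h j hj => ?_, fun h j hj => ?_⟩
        · rw [List.mem_cons, not_or] at hj
          simpa [hj.1] using h j hj.2
        · by_cases hji : j = i
          · subst hji; simp
          · simpa [hji] using h j (by simp [hji, hj])
      simp only [hcond]
      split_ifs
      · congr 1
        refine Finset.prod_congr rfl fun j hj => ?_
        have : j ≠ i := fun h => hi' (h ▸ hj)
        simp [this]
      · simp
    · intro c _ hc
      rw [if_neg, mul_zero]
      intro h
      exact hc (by simpa using h i hi)
    · simp

theorem Layer.ofSingle_toMatrix_apply (u : (i : ι) → Matrix.unitaryGroup (Fin (dim i)) ℂ)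
    (x y : Config dim) : (Layer.ofSingle u).toMatrix x y = ∏ i, (u i).1 (x i) (y i) := by
  have h : (Layer.ofSingle u).toMatrix =
      ((Finset.univ : Finset ι).toList.map fun i => onWire i (u i).1).prod := by
    rw [Layer.toMatrix, Layer.ofSingle, List.map_map]
    rfl
  rw [h, list_prod_onWire_apply (fun i => (u i).1) _ (Finset.nodup_toList _)]
  simp

theorem diagonal_circle_mem_unitary {X : Type*} [Fintype X] [DecidableEq X] (f : X → Circle) :
    Matrix.diagonal (fun x => (f x : ℂ)) ∈ Matrix.unitaryGroup X ℂ := by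
  rw [Matrix.mem_unitaryGroup_iff, Matrix.star_eq_conjTranspose, Matrix.diagonal_conjTranspose,
    Matrix.diagonal_mul_diagonal, ← Matrix.diagonal_one]
  congr 1
  funext x
  rw [Pi.star_apply, Complex.star_def, Complex.mul_conj, Circle.normSq_coe, Complex.ofReal_one]

/-- The unitary `∑ x, f x |x⟩⟨x|`. -/
noncomputable def diagonalU {X : Type*} [Fintype X] [DecidableEq X] (f : X → Circle) :
    Matrix.unitaryGroup X ℂ :=
  ⟨Matrix.diagonal fun x => (f x : ℂ), diagonal_circle_mem_unitary f⟩

/-- The diagonal gate with phases `f` on the wires `i` and `j`. -/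
noncomputable def Gate.phase (i j : ι) (f : Fin (dim i) → Fin (dim j) → Circle) : Gate dim where
  support := {i, j}
  card_le := Finset.card_le_two
  mat := diagonalU fun x => f (x ⟨i, by simp⟩) (x ⟨j, by simp⟩)

theorem Gate.phase_toMatrix (i j : ι) (f : Fin (dim i) → Fin (dim j) → Circle) :
    (Gate.phase i j f).toMatrix =
      Matrix.diagonal fun x : Config dim => (f (x i) (x j) : ℂ) :=
  embed_diagonal _ _

/-- Diagonal gates on the disjoint pairs of wires `p t`, `q t`. -/
noncomputable def Layer.phases {n : ℕ} (p q : Fin n → ι)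
    (f : (t : Fin n) → Fin (dim (p t)) → Fin (dim (q t)) → Circle)
    (hp : Function.Injective p) (hq : Function.Injective q) (hpq : ∀ s t, p s ≠ q t) :
    Layer dim where
  gates := (List.finRange n).map fun t => Gate.phase (p t) (q t) (f t)
  disjoint := by
    rw [List.pairwise_map]
    refine (List.nodup_finRange n).imp fun {s t} hst => ?_
    simp only [Gate.phase, Finset.disjoint_insert_left, Finset.disjoint_insert_right,
      Finset.mem_insert, Finset.mem_singleton, Finset.disjoint_singleton]
    simp [hp.eq_iff, hq.eq_iff, hst, hst.symm, hpq]

theorem Layer.phases_toMatrix {n : ℕ} (p q : Fin n → ι)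
    (f : (t : Fin n) → Fin (dim (p t)) → Fin (dim (q t)) → Circle)
    (hp : Function.Injective p) (hq : Function.Injective q) (hpq : ∀ s t, p s ≠ q t) :
    (Layer.phases p q f hp hq hpq).toMatrix =
      Matrix.diagonal fun x : Config dim => ∏ t, (f t (x (p t)) (x (q t)) : ℂ) := by
  have h : ∀ l : List (Fin n),
      (l.map fun t => (Gate.phase (p t) (q t) (f t)).toMatrix).prod =
        Matrix.diagonal fun x : Config dim =>
          (l.map fun t => (f t (x (p t)) (x (q t)) : ℂ)).prod := by
    intro l
    induction l with
    | nil => simp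
    | cons t l ih =>
      rw [List.map_cons, List.prod_cons, ih, Gate.phase_toMatrix, Matrix.diagonal_mul_diagonal]
      simp
  rw [Layer.toMatrix, Layer.phases, List.map_map]
  refine (h _).trans ?_
  simp only [← List.ofFn_eq_map, List.prod_ofFn]

namespace AdaptiveCircuit

variable {α β : Type} [DecidableEq β]

theorem run_add (c : AdaptiveCircuit dim β) (b : β) (ρ σ : Matrix (Config dim) (Config dim) ℂ) :
    c.run b (ρ + σ) = c.run b ρ + c.run b σ := by
  induction c generalizing ρ σ with
  | done b' => by_cases h : b' = b <;> simp [run, h]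
  | layer L next ih => simp only [run, mul_add, add_mul, ih]
  | measure S next ih => simp only [run, mul_add, add_mul, ih, Finset.sum_add_distrib]

theorem run_sum {T : Type*} (c : AdaptiveCircuit dim β) (b : β) (s : Finset T)
    (ρ : T → Matrix (Config dim) (Config dim) ℂ) :
    c.run b (∑ t ∈ s, ρ t) = ∑ t ∈ s, c.run b (ρ t) :=
  map_sum (AddMonoidHom.mk' (c.run b) (c.run_add b)) ρ s

/-- A `Unit` output carries no information, so the continuation is the same in all branches and,
being linear, may be run on their sum. -/
theorem run_bind_unit (c : AdaptiveCircuit dim Unit) (f : Unit → AdaptiveCircuit dim β) (b : β)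
    (ρ : Matrix (Config dim) (Config dim) ℂ) :
    (c.bind f).run b ρ = (f ()).run b (c.run () ρ) := by
  induction c generalizing ρ with
  | done b' => simp [run, bind]
  | layer L next ih => simp only [run, bind, ih]
  | measure S next ih => simp only [run, bind, ih, run_sum]

end AdaptiveCircuit

end Register

/-! ### Splitting off the additional ancillas -/

section Labels

variable {a n r : ℕ}

/-- The basis label with given parts on the system, the control and the additional ancillas. -/
def mkConfig (m : Sys a n) (c : Fin (a * n + 1)) (w : Fin r → Fin (a * n + 1)) :
    Config (wireDim a n r)
  | Sum.inl i => m i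
  | Sum.inr j => (Fin.cons c w : Fin (r + 1) → Fin (a * n + 1)) j

/-- Basis labels correspond to triples of their parts. -/
def configEquiv : (Sys a n × Fin (a * n + 1)) × (Fin r → Fin (a * n + 1)) ≃
    Config (wireDim a n r) where
  toFun z := mkConfig z.1.1 z.1.2 z.2
  invFun x := ((sysPart x, ctrlPart x), ancPart x)
  left_inv _ := rfl
  right_inv x := by
    funext i
    rcases i with i | j
    · rfl
    · refine Fin.cases ?_ (fun j => ?_) j <;> rfl

theorem prod_config {M : Type*} [CommMonoid M] (f : Fin n ⊕ Fin (r + 1) → M) :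
    ∏ i, f i = (∏ i, f (Sum.inl i)) * (f (Sum.inr 0) * ∏ j : Fin r, f (Sum.inr j.succ)) := by
  rw [Fintype.prod_sum_type, Fin.prod_univ_succ]

/-- The isometry `|z⟩ ↦ |z⟩|0⟩^{⊗ r}` that adds the additional ancillas. -/
def ancIsometry (a n r : ℕ) :
    Matrix (Config (wireDim a n r)) (Sys a n × Fin (a * n + 1)) ℂ :=
  Matrix.of fun x z => if x = mkConfig z.1 z.2 0 then 1 else 0

theorem ancIsometry_apply (x : Config (wireDim a n r)) (z : Sys a n × Fin (a * n + 1)) :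
    ancIsometry a n r x z = if x = mkConfig z.1 z.2 0 then 1 else 0 := rfl

theorem ancIsometry_configEquiv (y : (Sys a n × Fin (a * n + 1)) × (Fin r → Fin (a * n + 1)))
    (z : Sys a n × Fin (a * n + 1)) :
    ancIsometry a n r (configEquiv y) z = if y.1 = z ∧ y.2 = 0 then 1 else 0 := by
  have h : configEquiv (r := r) y = mkConfig z.1 z.2 0 ↔ y.1 = z ∧ y.2 = 0 := by
    rw [show mkConfig z.1 z.2 0 = configEquiv (r := r) (z, 0) from rfl,
      configEquiv.apply_eq_iff_eq, Prod.ext_iff]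
  rw [ancIsometry_apply]
  simp only [h]

theorem mul_ancIsometry_apply {R : Type*}
    (M : Matrix R (Config (wireDim a n r)) ℂ) (x : R)
    (z : Sys a n × Fin (a * n + 1)) :
    (M * ancIsometry a n r) x z = M x (configEquiv (z, 0)) := by
  rw [Matrix.mul_apply, Finset.sum_eq_single (configEquiv (z, 0))]
  · rw [ancIsometry_configEquiv]
    simp
  · intro y _ hy
    rw [ancIsometry_apply, if_neg, mul_zero]
    exact hy
  · simp

theorem ancIsometry_mul_apply {R : Type*} (M : Matrix (Sys a n × Fin (a * n + 1)) R ℂ)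
    (y : (Sys a n × Fin (a * n + 1)) × (Fin r → Fin (a * n + 1))) (z : R) :
    (ancIsometry a n r * M) (configEquiv y) z = if y.2 = 0 then M y.1 z else 0 := by
  rw [Matrix.mul_apply]
  simp only [ancIsometry_configEquiv]
  split_ifs with h <;> simp [h]

theorem withAncillas_apply
    (ρ : Matrix (Sys a n × Fin (a * n + 1)) (Sys a n × Fin (a * n + 1)) ℂ)
    (x y : (Sys a n × Fin (a * n + 1)) × (Fin r → Fin (a * n + 1))) :
    withAncillas ρ (configEquiv x) (configEquiv y) =
      if x.2 = 0 ∧ y.2 = 0 then ρ x.1 y.1 else 0 := rfl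

theorem withAncillas_eq
    (ρ : Matrix (Sys a n × Fin (a * n + 1)) (Sys a n × Fin (a * n + 1)) ℂ) :
    withAncillas (r := r) ρ = ancIsometry a n r * ρ * (ancIsometry a n r)ᴴ := by
  ext x y
  obtain ⟨x, rfl⟩ := configEquiv.surjective x
  obtain ⟨y, rfl⟩ := configEquiv.surjective y
  rw [Matrix.mul_assoc, ancIsometry_mul_apply, ← Matrix.conjTranspose_conjTranspose ρ,
    ← Matrix.conjTranspose_mul, Matrix.conjTranspose_apply, ancIsometry_mul_apply]
  by_cases hx : x.2 = 0 <;> by_cases hy : y.2 = 0 <;>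
    simp [withAncillas_apply, hx, hy]

/-- Reduces statements about density operators on the full register to an intertwining relation with
the ancilla isometry, in which the additional ancillas enter in |0⟩ and leave in |0⟩. -/
theorem conj_withAncillas {M : Matrix (Config (wireDim a n r)) (Config (wireDim a n r)) ℂ}
    {G : Matrix (Sys a n × Fin (a * n + 1)) (Sys a n × Fin (a * n + 1)) ℂ}
    (h : M * ancIsometry a n r = ancIsometry a n r * G)
    (ρ : Matrix (Sys a n × Fin (a * n + 1)) (Sys a n × Fin (a * n + 1)) ℂ) :
    M * withAncillas ρ * Mᴴ = withAncillas (G * ρ * Gᴴ) := by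
  have h' := congrArg Matrix.conjTranspose h
  rw [Matrix.conjTranspose_mul, Matrix.conjTranspose_mul] at h'
  calc M * withAncillas ρ * Mᴴ
      = (M * ancIsometry a n r) * ρ * ((ancIsometry a n r)ᴴ * Mᴴ) := by
        rw [withAncillas_eq]; simp only [Matrix.mul_assoc]
    _ = withAncillas (G * ρ * Gᴴ) := by
        rw [h, h', withAncillas_eq]; simp only [Matrix.mul_assoc]

/-- The operator `V^{⊗ n} ⊗ H` on the system and the control. -/
def sideOp (V : Matrix (Fin (a + 1)) (Fin (a + 1)) ℂ)
    (H : Matrix (Fin (a * n + 1)) (Fin (a * n + 1)) ℂ) :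
    Matrix (Sys a n × Fin (a * n + 1)) (Sys a n × Fin (a * n + 1)) ℂ :=
  Matrix.of fun z w => (∏ i, V (z.1 i) (w.1 i)) * H z.2 w.2

theorem prod_one_apply {ι X : Type*} [Fintype ι] [DecidableEq X] (x y : ι → X) :
    ∏ i, (1 : Matrix X X ℂ) (x i) (y i) = if x = y then 1 else 0 := by
  classical
  simp only [Matrix.one_apply]
  rw [Finset.prod_ite_zero]
  simp [funext_iff]

theorem sideLayer_apply (V : Matrix.unitaryGroup (Fin (a + 1)) ℂ)
    (H : Matrix.unitaryGroup (Fin (a * n + 1)) ℂ)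
    (x y : (Sys a n × Fin (a * n + 1)) × (Fin r → Fin (a * n + 1))) :
    (sideLayer V H).toMatrix (configEquiv x) (configEquiv y) =
      sideOp V.1 H.1 x.1 y.1 * if x.2 = y.2 then 1 else 0 := by
  rw [sideLayer, Layer.ofSingle_toMatrix_apply, prod_config, ← prod_one_apply, sideOp,
    Matrix.of_apply, mul_assoc]
  rfl

theorem sideLayer_mul_ancIsometry (V : Matrix.unitaryGroup (Fin (a + 1)) ℂ)
    (H : Matrix.unitaryGroup (Fin (a * n + 1)) ℂ) :
    (sideLayer (r := r) V H).toMatrix * ancIsometry a n r =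
      ancIsometry a n r * sideOp V.1 H.1 := by
  ext x z
  obtain ⟨x, rfl⟩ := configEquiv.surjective x
  rw [mul_ancIsometry_apply, ancIsometry_mul_apply, sideLayer_apply]
  split_ifs <;> simp

theorem outcomeProj_ctrl_mul_ancIsometry
    (y : (i : ({Sum.inr 0} : Finset (Fin n ⊕ Fin (r + 1)))) → Fin (wireDim a n r i)) :
    outcomeProj {Sum.inr 0} y * ancIsometry a n r = ancIsometry a n r *
      Matrix.diagonal fun z : Sys a n × Fin (a * n + 1) =>
        if (z.2 : ℕ) = ((y ⟨Sum.inr 0, Finset.mem_singleton_self _⟩ : Fin (a * n + 1)) : ℕ)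
          then (1 : ℂ) else 0 := by
  ext x z
  obtain ⟨x, rfl⟩ := configEquiv.surjective x
  have h : (∀ i : ({Sum.inr 0} : Finset (Fin n ⊕ Fin (r + 1))), configEquiv x i = y i) ↔
      (x.1.2 : ℕ) = ((y ⟨Sum.inr 0, Finset.mem_singleton_self _⟩ : Fin (a * n + 1)) : ℕ) := by
    refine ⟨fun h => congrArg Fin.val (h ⟨Sum.inr 0, Finset.mem_singleton_self _⟩), ?_⟩
    rintro h ⟨i, hi⟩
    obtain rfl := Finset.mem_singleton.1 hi
    exact Fin.ext h
  rw [ancIsometry_mul_apply, outcomeProj, Matrix.diagonal_mul, ancIsometry_configEquiv]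
  simp only [h]
  by_cases h1 : x.1 = z
  · subst h1
    by_cases h2 : x.2 = 0 <;> simp [h2]
  · by_cases h2 : x.2 = 0 <;> simp [h1, h2]

end Labels

/-! ### Fourier analysis on ℤ/d -/

section Characters

open ZMod

/-- The basis label of a `d`-level qudit as a residue modulo `d`. -/
def toZMod {d : ℕ} (x : Fin d) : ZMod d := ((x : ℕ) : ZMod d)

theorem toZMod_bijective (d : ℕ) [NeZero d] : Function.Bijective (toZMod (d := d)) := by
  rw [Fintype.bijective_iff_injective_and_card]
  refine ⟨fun x y h => Fin.ext ?_, by simp [ZMod.card]⟩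
  have := (ZMod.natCast_eq_natCast_iff _ _ _).1 h
  rwa [Nat.ModEq, Nat.mod_eq_of_lt x.2, Nat.mod_eq_of_lt y.2] at this

theorem hadamard_apply (d : ℕ) [NeZero d] (y x : Fin d) :
    hadamard d y x = ((Real.sqrt d : ℝ) : ℂ)⁻¹ * stdAddChar (toZMod x * toZMod y) := by
  have h : toZMod x * toZMod y = (((x : ℕ) * (y : ℕ) : ℤ) : ZMod d) := by
    simp [toZMod]
  rw [h, stdAddChar_coe, hadamard]
  congr 2
  push_cast
  ring

theorem sum_stdAddChar_mul (d : ℕ) [NeZero d] (t : ZMod d) :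
    ∑ x : Fin d, stdAddChar (toZMod x * t) = if t = 0 then (d : ℂ) else 0 := by
  rw [(toZMod_bijective d).sum_comp fun u => stdAddChar (u * t)]
  simp [AddChar.sum_mulShift t (isPrimitive_stdAddChar d), ZMod.card]

/-- K is diagonal with the level as eigenvalue, so the exponential is taken entrywise. As the phases
are d-th roots of unity, they depend only on residues modulo d. -/
theorem controlledU_eq (a n : ℕ) :
    controlledU a n = Matrix.diagonal fun z : Sys a n × Fin (a * n + 1) =>
      stdAddChar (toZMod z.2 * ∑ i, ((z.1 i : ℕ) : ZMod (a * n + 1))) := by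
  have hK : opK a n = Matrix.diagonal fun m : Sys a n => ∑ i, ((m i : ℕ) : ℂ) := by
    simp only [opK, onWire_diagonal]
    ext x y
    rw [Matrix.sum_apply]
    by_cases h : x = y
    · subst h; simp
    · simp [h]
  have hU : ∀ x : Fin (a * n + 1), opU a n x = Matrix.diagonal fun m : Sys a n =>
      stdAddChar (toZMod x * ∑ i, ((m i : ℕ) : ZMod (a * n + 1))) := by
    intro x
    rw [opU, hK, ← Matrix.diagonal_smul, Matrix.exp_diagonal]
    congr 1
    funext m
    have h : toZMod x * ∑ i, ((m i : ℕ) : ZMod (a * n + 1)) =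
        (((x : ℕ) * ∑ i, (m i : ℕ) : ℤ) : ZMod (a * n + 1)) := by
      simp [toZMod]
    rw [h, stdAddChar_coe, Pi.exp_def, ← Complex.exp_eq_exp_ℂ]
    simp only [Pi.smul_apply, smul_eq_mul]
    congr 1
    push_cast
    ring
  ext z w
  rw [controlledU, hU]
  by_cases h : z = w
  · subst h; simp
  · rw [Matrix.diagonal_apply_ne _ h]
    split_ifs with h2
    · exact Matrix.diagonal_apply_ne _ fun h1 => h (Prod.ext h1 h2)
    · rfl

end Characters

/-! ### Fan-out of the control through a cluster state -/

section ControlledPhase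

open ZMod

variable {a n : ℕ}

/-- Wires holding the copies of the control produced by fan-out; copy `0` is the control itself. -/
def copyWire (n : ℕ) (i : Fin (n + 1)) : Fin n ⊕ Fin (n + n + 1) :=
  Sum.inr ((Fin.cons 0 fun i => (Fin.castAdd n i).succ : Fin (n + 1) → Fin (n + n + 1)) i)

/-- Wires comparing consecutive copies of the control. -/
def parityWire (n : ℕ) (i : Fin n) : Fin n ⊕ Fin (n + n + 1) := Sum.inr (Fin.natAdd n i).succ

@[simp] theorem copyWire_zero : copyWire n 0 = Sum.inr 0 := rfl

@[simp] theorem copyWire_succ (i : Fin n) :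
    copyWire n i.succ = Sum.inr (Fin.castAdd n i).succ := rfl

theorem copyWire_injective : Function.Injective (copyWire n) := by
  intro i j h
  refine Fin.cases (motive := fun i => copyWire n i = copyWire n j → i = j) ?_ (fun i => ?_) i h
    <;> refine Fin.cases ?_ (fun j => ?_) j <;> simp
  exact fun h => absurd h.symm (Fin.succ_ne_zero _)

theorem parityWire_injective : Function.Injective (parityWire n) := by
  intro i j h
  simpa [parityWire] using h

theorem parityWire_ne_copyWire (i : Fin n) (j : Fin (n + 1)) : parityWire n i ≠ copyWire n j := by
  refine Fin.cases ?_ (fun j => ?_) j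
  · simp [parityWire]
  · rw [parityWire, copyWire_succ, ne_eq, Sum.inr.injEq, Fin.succ_inj, Fin.ext_iff,
      Fin.val_natAdd, Fin.val_castAdd]
    omega

/-- The layer that applies `H_d` to every additional ancilla. -/
noncomputable def ancHadamard (a n r : ℕ) : Layer (wireDim a n r) :=
  Layer.ofSingle fun i => match i with
    | Sum.inl _ => 1
    | Sum.inr j => if j = 0 then 1 else hadamardU (a * n + 1)

theorem ancHadamard_apply {r : ℕ}
    (x y : (Sys a n × Fin (a * n + 1)) × (Fin r → Fin (a * n + 1))) :
    (ancHadamard a n r).toMatrix (configEquiv x) (configEquiv y) =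
      if x.1 = y.1 then ∏ j, hadamard (a * n + 1) (x.2 j) (y.2 j) else 0 := by
  have h : (if x.1 = y.1 then ∏ j, hadamard (a * n + 1) (x.2 j) (y.2 j) else 0) =
      (∏ i, (1 : Matrix (Fin (a + 1)) (Fin (a + 1)) ℂ) (x.1.1 i) (y.1.1 i)) *
        ((1 : Matrix (Fin (a * n + 1)) (Fin (a * n + 1)) ℂ) x.1.2 y.1.2 *
          ∏ j, hadamard (a * n + 1) (x.2 j) (y.2 j)) := by
    rw [prod_one_apply, Matrix.one_apply]
    simp only [Prod.ext_iff]
    by_cases h1 : x.1.1 = y.1.1 <;> by_cases h2 : x.1.2 = y.1.2 <;> simp [h1, h2]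
  rw [h, ancHadamard, Layer.ofSingle_toMatrix_apply, prod_config]
  rfl

/-- The gates `|u⟩|v⟩ ↦ χ(-u v)|u⟩|v⟩` on the parity wires and the following copies. -/
noncomputable def nextCopyLayer (a n : ℕ) : Layer (wireDim a n (n + n)) :=
  Layer.phases (parityWire n) (fun i => copyWire n i.succ)
    (fun _ u v => toCircle (-(toZMod (d := a * n + 1) u * toZMod (d := a * n + 1) v)))
    parityWire_injective (copyWire_injective.comp (Fin.succ_injective n))
    fun _ _ => parityWire_ne_copyWire _ _

/-- The gates `|u⟩|v⟩ ↦ χ(u v)|u⟩|v⟩` on the parity wires and the preceding copies. -/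
noncomputable def prevCopyLayer (a n : ℕ) : Layer (wireDim a n (n + n)) :=
  Layer.phases (parityWire n) (fun i => copyWire n i.castSucc)
    (fun _ u v => toCircle (toZMod (d := a * n + 1) u * toZMod (d := a * n + 1) v))
    parityWire_injective (copyWire_injective.comp (Fin.castSucc_injective n))
    fun _ _ => parityWire_ne_copyWire _ _

/-- The gates `|m⟩|v⟩ ↦ χ(m v)|m⟩|v⟩` on the system qudits and the copies of the control. -/
noncomputable def sysCopyLayer (a n : ℕ) : Layer (wireDim a n (n + n)) :=
  Layer.phases Sum.inl (fun i => copyWire n i.succ)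
    (fun _ m v => toCircle ((((m : Fin (a + 1)) : ℕ) : ZMod (a * n + 1)) *
      toZMod (d := a * n + 1) v))
    Sum.inl_injective (copyWire_injective.comp (Fin.succ_injective n))
    fun _ _ => by simp

/-- The value of copy `i` of the control. -/
def copyVal (c : Fin (a * n + 1)) (w : Fin (n + n) → Fin (a * n + 1)) (i : Fin (n + 1)) :
    ZMod (a * n + 1) :=
  toZMod ((Fin.cons c fun i => w (Fin.castAdd n i) : Fin (n + 1) → Fin (a * n + 1)) i)

theorem copyVal_eq (x : (Sys a n × Fin (a * n + 1)) × (Fin (n + n) → Fin (a * n + 1)))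
    (i : Fin (n + 1)) :
    toZMod (d := a * n + 1) (configEquiv x (copyWire n i)) = copyVal x.1.2 x.2 i := by
  refine Fin.cases ?_ (fun i => ?_) i <;> rfl

/-- The Hadamard gates and phase gates of the fan-out, as one unitary. -/
noncomputable def fanoutOp (a n : ℕ) :
    Matrix (Config (wireDim a n (n + n))) (Config (wireDim a n (n + n))) ℂ :=
  (ancHadamard a n (n + n)).toMatrix * ((sysCopyLayer a n).toMatrix *
    ((prevCopyLayer a n).toMatrix * ((nextCopyLayer a n).toMatrix *
      (ancHadamard a n (n + n)).toMatrix)))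

/-- The phase acquired by a basis state in the diagonal layers. -/
noncomputable def fanoutPhase (z : Sys a n × Fin (a * n + 1))
    (w : Fin (n + n) → Fin (a * n + 1)) : ℂ :=
  ∏ i, (stdAddChar (((z.1 i : ℕ) : ZMod (a * n + 1)) * copyVal z.2 w i.succ) *
    (stdAddChar (toZMod (w (Fin.natAdd n i)) * copyVal z.2 w i.castSucc) *
      stdAddChar (-(toZMod (w (Fin.natAdd n i)) * copyVal z.2 w i.succ))))

theorem fanout_diagonal :
    (sysCopyLayer a n).toMatrix * ((prevCopyLayer a n).toMatrix * (nextCopyLayer a n).toMatrix) =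
      Matrix.diagonal fun x => fanoutPhase (configEquiv.symm x).1 (configEquiv.symm x).2 := by
  have h1 : (sysCopyLayer a n).toMatrix = Matrix.diagonal _ := Layer.phases_toMatrix _ _ _ _ _ _
  have h2 : (prevCopyLayer a n).toMatrix = Matrix.diagonal _ := Layer.phases_toMatrix _ _ _ _ _ _
  have h3 : (nextCopyLayer a n).toMatrix = Matrix.diagonal _ := Layer.phases_toMatrix _ _ _ _ _ _
  rw [h1, h2, h3, Matrix.diagonal_mul_diagonal, Matrix.diagonal_mul_diagonal]
  congr 1
  funext x
  obtain ⟨x, rfl⟩ := configEquiv.surjective x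
  simp only [fanoutPhase, Finset.prod_mul_distrib, ← copyVal_eq, Equiv.symm_apply_apply]
  rfl

/-- The amplitude of the ancilla outcome `o` after the fan-out unitary. -/
noncomputable def fanoutAmp (z : Sys a n × Fin (a * n + 1))
    (o : Fin (n + n) → Fin (a * n + 1)) : ℂ :=
  ∑ w : Fin (n + n) → Fin (a * n + 1), (∏ j, hadamard (a * n + 1) (o j) (w j)) *
    (fanoutPhase z w * ∏ j, hadamard (a * n + 1) (w j) 0)

/-- The Hadamards touch only the additional ancillas and everything else is diagonal, so the labels
of the system and the control are preserved and a single amplitude remains. -/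
theorem fanoutOp_mul_ancIsometry_apply
    (y : (Sys a n × Fin (a * n + 1)) × (Fin (n + n) → Fin (a * n + 1)))
    (z : Sys a n × Fin (a * n + 1)) :
    (fanoutOp a n * ancIsometry a n (n + n)) (configEquiv y) z =
      if y.1 = z then fanoutAmp z y.2 else 0 := by
  have h : fanoutOp a n = (ancHadamard a n (n + n)).toMatrix *
      ((Matrix.diagonal fun x => fanoutPhase (configEquiv.symm x).1 (configEquiv.symm x).2) *
        (ancHadamard a n (n + n)).toMatrix) := by
    rw [← fanout_diagonal]
    simp only [fanoutOp, Matrix.mul_assoc]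
  rw [mul_ancIsometry_apply, h, Matrix.mul_apply, ← configEquiv.sum_comp, Fintype.sum_prod_type,
    Finset.sum_eq_single z]
  · simp only [Matrix.diagonal_mul, ancHadamard_apply, Equiv.symm_apply_apply, if_true]
    split_ifs
    · rfl
    · simp
  · intro z' _ hz'
    refine Finset.sum_eq_zero fun w _ => ?_
    simp [Matrix.diagonal_mul, ancHadamard_apply, hz']
  · simp

/-- The offset of copy `i` of the control, given the outcomes on the parity wires. -/
noncomputable def copyOffset (o : Fin (n + n) → Fin (a * n + 1)) (i : Fin n) :
    ZMod (a * n + 1) :=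
  Fin.partialSum (fun l : Fin n => toZMod (o (Fin.natAdd n l))) i.succ

/-- The parity constraints form a first-order recurrence started at `c`; telescoping gives its
unique solution. -/
theorem parity_iff {R : Type*} [AddCommGroup R] (c : R) (j y : Fin n → R) :
    (∀ i : Fin n, y i + (Fin.cons c j : Fin (n + 1) → R) i.castSucc - j i = 0) ↔
      j = fun i => c + Fin.partialSum y i.succ := by
  constructor
  · intro h
    have hJ : ∀ i : Fin (n + 1), (Fin.cons c j : Fin (n + 1) → R) i = c + Fin.partialSum y i := by
      intro i
      induction i using Fin.induction with
      | zero => simp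
      | succ i ih =>
        have := h i
        rw [ih, sub_eq_zero] at this
        rw [Fin.cons_succ, ← this, Fin.partialSum_succ]
        abel
    funext i
    simpa using hJ i.succ
  · rintro rfl i
    have hJ : ∀ i : Fin (n + 1), (Fin.cons c fun i => c + Fin.partialSum y i.succ :
        Fin (n + 1) → R) i = c + Fin.partialSum y i := by
      intro i
      refine Fin.cases ?_ (fun i => ?_) i <;> simp
    rw [hJ]
    beta_reduce
    rw [Fin.partialSum_succ]
    abel

/-- The exponent is linear in the parity labels, so summing over them produces delta functions that
fix all the copies. One term survives, and its phase is a product over the system qudits. -/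
theorem fanoutAmp_eq (z : Sys a n × Fin (a * n + 1)) (o : Fin (n + n) → Fin (a * n + 1)) :
    fanoutAmp z o = ((((Real.sqrt (a * n + 1 : ℕ))⁻¹) ^ (4 * n) * (a * n + 1 : ℕ) ^ n : ℝ) : ℂ) *
      ∏ i, stdAddChar ((toZMod z.2 + copyOffset o i) *
        (toZMod (o (Fin.castAdd n i)) + ((z.1 i : ℕ) : ZMod (a * n + 1)))) := by
  have hterm : ∀ w : Fin (n + n) → Fin (a * n + 1),
      (∏ j, hadamard (a * n + 1) (o j) (w j)) *
        (fanoutPhase z w * ∏ j, hadamard (a * n + 1) (w j) 0) =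
      (((Real.sqrt (a * n + 1 : ℕ) : ℝ) : ℂ)⁻¹) ^ (4 * n) *
        ((∏ i, stdAddChar (copyVal z.2 w (Fin.succ i) * (toZMod (o (Fin.castAdd n i)) +
          ((z.1 i : ℕ) : ZMod (a * n + 1))))) *
        ∏ i, stdAddChar (toZMod (w (Fin.natAdd n i)) * (toZMod (o (Fin.natAdd n i)) +
          copyVal z.2 w (Fin.castSucc i) - copyVal z.2 w (Fin.succ i)))) := by
    intro w
    have h0 : toZMod (0 : Fin (a * n + 1)) = 0 := by simp [toZMod]
    simp only [hadamard_apply, h0, zero_mul, AddChar.map_zero_eq_one, mul_one,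
      Finset.prod_mul_distrib, Finset.prod_const, Finset.card_univ, Fintype.card_fin,
      Fin.prod_univ_add, fanoutPhase]
    -- Each of the 2n ancillas meets two Hadamards, with a factor d^(-1/2) each.
    rw [show 4 * n = (n + n) + (n + n) by ring, pow_add]
    have e1 : ∀ i : Fin n, copyVal z.2 w i.succ = toZMod (w (Fin.castAdd n i)) := fun i => rfl
    have key : ∀ i : Fin n, stdAddChar (toZMod (w (Fin.castAdd n i)) * toZMod (o (Fin.castAdd n i)))
        * (stdAddChar (toZMod (w (Fin.natAdd n i)) * toZMod (o (Fin.natAdd n i))) *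
        (stdAddChar (((z.1 i : ℕ) : ZMod (a * n + 1)) * copyVal z.2 w i.succ) *
          (stdAddChar (toZMod (w (Fin.natAdd n i)) * copyVal z.2 w i.castSucc) *
            stdAddChar (-(toZMod (w (Fin.natAdd n i)) * copyVal z.2 w i.succ))))) =
        stdAddChar (copyVal z.2 w (Fin.succ i) * (toZMod (o (Fin.castAdd n i)) +
          ((z.1 i : ℕ) : ZMod (a * n + 1)))) *
        stdAddChar (toZMod (w (Fin.natAdd n i)) * (toZMod (o (Fin.natAdd n i)) +
          copyVal z.2 w (Fin.castSucc i) - copyVal z.2 w (Fin.succ i))) := by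
      intro i
      simp only [← AddChar.map_add_eq_mul, e1]
      congr 1
      ring
    have key' := Finset.prod_congr (rfl : (Finset.univ : Finset (Fin n)) = Finset.univ)
      fun i _ => key i
    simp only [Finset.prod_mul_distrib] at key'
    rw [← key']
    ring
  rw [fanoutAmp]
  simp only [hterm]
  -- Split the ancilla label into the copies `j` and the parity labels `α`.
  rw [← Finset.mul_sum, ← (Fin.appendEquiv n n).sum_comp, Fintype.sum_prod_type]
  have hcv : ∀ (j α : Fin n → Fin (a * n + 1)) (i : Fin (n + 1)),
      copyVal z.2 (Fin.append j α) i =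
        (Fin.cons (toZMod z.2) (fun i => toZMod (j i)) : Fin (n + 1) → ZMod (a * n + 1)) i := by
    intro j α i
    refine Fin.cases ?_ (fun i => ?_) i <;> simp [copyVal]
  -- The only copy values compatible with the parity outcomes.
  obtain ⟨j₀, hj₀⟩ : ∃ j₀ : Fin n → Fin (a * n + 1),
      (fun i => toZMod (j₀ i)) = fun i => toZMod z.2 + copyOffset o i :=
    ⟨fun i => ((toZMod_bijective (a * n + 1)).surjective (toZMod z.2 + copyOffset o i)).choose,
      funext fun i =>
        ((toZMod_bijective (a * n + 1)).surjective (toZMod z.2 + copyOffset o i)).choose_spec⟩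
  have hsum : ∀ j : Fin n → Fin (a * n + 1), (∑ α : Fin n → Fin (a * n + 1),
      ∏ i, stdAddChar (toZMod (α i) * (toZMod (o (Fin.natAdd n i)) +
        (Fin.cons (toZMod z.2) (fun i => toZMod (j i)) : Fin (n + 1) → ZMod (a * n + 1))
          i.castSucc - toZMod (j i)))) = if j = j₀ then ((a * n + 1 : ℕ) : ℂ) ^ n else 0 := by
    intro j
    rw [← Fintype.prod_sum fun (i : Fin n) (x : Fin (a * n + 1)) =>
      stdAddChar (toZMod x * (toZMod (o (Fin.natAdd n i)) +
        (Fin.cons (toZMod z.2) (fun i => toZMod (j i)) : Fin (n + 1) → ZMod (a * n + 1))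
          i.castSucc - toZMod (j i)))]
    simp only [sum_stdAddChar_mul]
    rw [Finset.prod_ite_zero]
    have : (∀ i ∈ (Finset.univ : Finset (Fin n)), toZMod (o (Fin.natAdd n i)) +
        (Fin.cons (toZMod z.2) (fun i => toZMod (j i)) : Fin (n + 1) → ZMod (a * n + 1))
          i.castSucc - toZMod (j i) = 0) ↔ j = j₀ := by
      have h := parity_iff (toZMod z.2) (fun i => toZMod (j i))
        (fun i => toZMod (o (Fin.natAdd n i)))
      simp only [Finset.mem_univ, true_imp_iff]
      rw [h]
      refine (Eq.congr_right hj₀.symm).trans ⟨fun h' => ?_, fun h' => h' ▸ rfl⟩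
      exact funext fun i => (toZMod_bijective (a * n + 1)).injective (congrFun h' i)
    simp only [this]
    simp
  rw [Finset.sum_eq_single j₀]
  · simp only [Fin.appendEquiv, Equiv.coe_fn_mk, hcv, Fin.cons_succ, Fin.append_right]
    rw [← Finset.mul_sum, hsum, if_pos rfl]
    simp only [fun i => congrFun hj₀ i]
    push_cast
    ring
  · intro j _ hj
    simp only [Fin.appendEquiv, Equiv.coe_fn_mk, hcv, Fin.cons_succ, Fin.append_right]
    rw [← Finset.mul_sum, hsum, if_neg hj, mul_zero]
  · simp

end ControlledPhase

/-! ### Measurement branches and their byproducts -/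

section Correction

open ZMod

variable {a n : ℕ}

/-- The unitary exchanging the levels `|o⟩` and `|0⟩`. -/
noncomputable def resetU {d : ℕ} [NeZero d] (o : Fin d) : Matrix.unitaryGroup (Fin d) ℂ :=
  ⟨(1 : Matrix (Fin d) (Fin d) ℂ).submatrix (Equiv.swap o 0) id, by
    rw [Matrix.mem_unitaryGroup_iff, Matrix.star_eq_conjTranspose, Matrix.conjTranspose_submatrix,
      Matrix.conjTranspose_one]
    have := Matrix.submatrix_mul_equiv (1 : Matrix (Fin d) (Fin d) ℂ) 1 (Equiv.swap o 0)
      (Equiv.refl _) (Equiv.swap o 0)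
    rw [Matrix.one_mul, Matrix.submatrix_one_equiv] at this
    exact this⟩

theorem resetU_apply {d : ℕ} [NeZero d] (o x : Fin d) :
    (resetU o).1 x o = if x = 0 then 1 else 0 := by
  have h : (resetU o).1 x o = (1 : Matrix (Fin d) (Fin d) ℂ) (Equiv.swap o 0 x) o := rfl
  rw [h, Matrix.one_apply]
  simp only [Equiv.swap_apply_eq_iff, Equiv.swap_apply_left]

/-- The layer undoing the byproduct of the outcome `o` on the additional ancillas. -/
noncomputable def correctionLayer (o : Fin (n + n) → Fin (a * n + 1)) :
    Layer (wireDim a n (n + n)) :=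
  Layer.ofSingle fun i => match i with
    | Sum.inl i => diagonalU fun m : Fin (a + 1) =>
        toCircle (-(copyOffset o i * ((m : ℕ) : ZMod (a * n + 1))))
    | Sum.inr j => Fin.cases (motive := fun _ => Matrix.unitaryGroup (Fin (a * n + 1)) ℂ)
        (diagonalU fun c => toCircle (-(toZMod c * ∑ i, toZMod (o (Fin.castAdd n i)))))
        (fun j => resetU (o j)) j

/-- The phase applied by the correction layer. -/
noncomputable def correctionPhase (o : Fin (n + n) → Fin (a * n + 1))
    (z : Sys a n × Fin (a * n + 1)) : ℂ :=
  (∏ i, stdAddChar (-(copyOffset o i * ((z.1 i : ℕ) : ZMod (a * n + 1))))) *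
    stdAddChar (-(toZMod z.2 * ∑ i, toZMod (o (Fin.castAdd n i))))

theorem diagonalU_apply {X : Type*} [Fintype X] [DecidableEq X] (f : X → Circle) (x y : X) :
    (diagonalU f).1 x y = (f y : ℂ) * (1 : Matrix X X ℂ) x y := by
  have h : (diagonalU f).1 x y = Matrix.diagonal (fun x => (f x : ℂ)) x y := rfl
  rw [h, Matrix.diagonal_apply, Matrix.one_apply]
  by_cases h : x = y <;> simp [h]

/-- Only columns with ancilla label `o` matter, because the layer follows a projection onto that
outcome. -/
theorem correctionLayer_apply (o : Fin (n + n) → Fin (a * n + 1))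
    (x : (Sys a n × Fin (a * n + 1)) × (Fin (n + n) → Fin (a * n + 1)))
    (z : Sys a n × Fin (a * n + 1)) :
    (correctionLayer o).toMatrix (configEquiv x) (configEquiv (z, o)) =
      if x.1 = z ∧ x.2 = 0 then correctionPhase o z else 0 := by
  have h : (correctionLayer o).toMatrix (configEquiv x) (configEquiv (z, o)) =
      (∏ i, (diagonalU fun m : Fin (a + 1) =>
        toCircle (-(copyOffset o i * ((m : ℕ) : ZMod (a * n + 1))))).1 (x.1.1 i) (z.1 i)) *
      ((diagonalU fun c => toCircle (-(toZMod c * ∑ i, toZMod (o (Fin.castAdd n i))))).1 x.1.2 z.2 *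
        ∏ j, (resetU (o j)).1 (x.2 j) (o j)) := by
    rw [correctionLayer, Layer.ofSingle_toMatrix_apply, prod_config]
    rfl
  rw [h]
  simp only [diagonalU_apply, resetU_apply, Finset.prod_mul_distrib]
  rw [prod_one_apply, Finset.prod_ite_zero, Matrix.one_apply]
  have h0 : (∀ i ∈ (Finset.univ : Finset (Fin (n + n))), x.2 i = 0) ↔ x.2 = 0 := by
    simp [funext_iff]
  simp only [h0, Prod.ext_iff, correctionPhase, stdAddChar_apply]
  by_cases h1 : x.1.1 = z.1 <;> by_cases h2 : x.1.2 = z.2 <;> by_cases h3 : x.2 = 0 <;>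
    simp [h1, h2, h3]

/-- The wires of the additional ancillas. -/
def ancWires (n r : ℕ) : Finset (Fin n ⊕ Fin (r + 1)) :=
  Finset.univ.map ⟨fun j : Fin r => Sum.inr j.succ,
    Sum.inr_injective.comp (Fin.succ_injective r)⟩

theorem mem_ancWires {r : ℕ} (j : Fin r) : Sum.inr j.succ ∈ ancWires n r := by
  simp [ancWires]

/-- The outcomes of a measurement of the additional ancillas, as a family. -/
def ancOutcome {r : ℕ} (y : (i : ancWires n r) → Fin (wireDim a n r i)) :
    Fin r → Fin (a * n + 1) :=
  fun j => y ⟨Sum.inr j.succ, mem_ancWires j⟩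

theorem card_ancOutcome (a n r : ℕ) :
    Fintype.card ((i : ancWires n r) → Fin (wireDim a n r i)) = (a * n + 1) ^ r := by
  rw [Fintype.card_pi]
  simp only [Fintype.card_fin]
  rw [Finset.prod_coe_sort (ancWires n r) (wireDim a n r), ancWires, Finset.prod_map]
  simp

theorem outcomeProj_ancWires {r : ℕ} (y : (i : ancWires n r) → Fin (wireDim a n r i)) :
    outcomeProj (ancWires n r) y = Matrix.diagonal fun x =>
      if (configEquiv.symm x).2 = ancOutcome y then 1 else 0 := by
  rw [outcomeProj]
  congr 1
  funext x
  obtain ⟨x, rfl⟩ := configEquiv.surjective x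
  have h : (∀ i : ancWires n r, configEquiv x i = y i) ↔ x.2 = ancOutcome y := by
    refine ⟨fun h => funext fun j => h ⟨Sum.inr j.succ, mem_ancWires j⟩, ?_⟩
    rintro h ⟨i, hi⟩
    obtain ⟨j, -, rfl⟩ := Finset.mem_map.1 hi
    exact congrFun h j
  simp only [h, Equiv.symm_apply_apply]

/-- Fan out the control to `n` ancillas through a measured cluster state, apply the phase gates
between the copies and the system, and measure out the copies. -/
noncomputable def fanoutCircuit (a n : ℕ) : AdaptiveCircuit (wireDim a n (n + n)) Unit :=
  .layer (ancHadamard a n (n + n)) <| .layer (nextCopyLayer a n) <| .layer (prevCopyLayer a n) <|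
    .layer (sysCopyLayer a n) <| .layer (ancHadamard a n (n + n)) <|
      .measure (ancWires n (n + n)) fun y =>
        .layer (correctionLayer (ancOutcome y)) (.done ())

/-- The scalar by which a branch of the fan-out circuit differs from the controlled gate. -/
noncomputable def branchScalar (o : Fin (n + n) → Fin (a * n + 1)) : ℂ :=
  ((((Real.sqrt (a * n + 1 : ℕ))⁻¹) ^ (4 * n) * (a * n + 1 : ℕ) ^ n : ℝ) : ℂ) *
    stdAddChar (∑ i, copyOffset o i * toZMod (o (Fin.castAdd n i)))

theorem prod_addChar {G M ι : Type*} [AddCommMonoid G] [CommMonoid M] (ψ : AddChar G M)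
    (s : Finset ι) (f : ι → G) : ∏ i ∈ s, ψ (f i) = ψ (∑ i ∈ s, f i) := by
  classical
  induction s using Finset.induction_on with
  | empty => simp
  | insert i s hi ih => rw [Finset.prod_insert hi, Finset.sum_insert hi, ih, ψ.map_add_eq_mul]

/-- Expand (c + offset)(o + m): the terms c·o and offset·m are undone by the correction, offset·o is
a global phase, and c·m is the wanted phase. -/
theorem correctionPhase_mul_fanoutAmp (z : Sys a n × Fin (a * n + 1))
    (o : Fin (n + n) → Fin (a * n + 1)) :
    correctionPhase o z * fanoutAmp z o = branchScalar o *
      stdAddChar (toZMod z.2 * ∑ i, ((z.1 i : ℕ) : ZMod (a * n + 1))) := by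
  rw [correctionPhase, fanoutAmp_eq, branchScalar, mul_left_comm]
  conv_rhs => rw [mul_assoc]
  congr 1
  simp only [prod_addChar, ← AddChar.map_add_eq_mul]
  congr 1
  simp only [add_mul, mul_add, Finset.sum_add_distrib, Finset.mul_sum, Finset.sum_neg_distrib]
  ring

/-- The outcome projection leaves one intermediate label, with ancilla part equal to the outcome;
there the corrected amplitude is a scalar times the phase of the gate. -/
theorem branch_mul_ancIsometry (y : (i : ancWires n (n + n)) → Fin (wireDim a n (n + n) i)) :
    (correctionLayer (ancOutcome y)).toMatrix * (outcomeProj _ y * fanoutOp a n) *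
      ancIsometry a n (n + n) =
    ancIsometry a n (n + n) * (branchScalar (ancOutcome y) • controlledU a n) := by
  ext x z
  obtain ⟨x, rfl⟩ := configEquiv.surjective x
  rw [ancIsometry_mul_apply, Matrix.mul_assoc, Matrix.mul_assoc, Matrix.mul_apply,
    ← configEquiv.sum_comp, Finset.sum_eq_single (z, ancOutcome y)]
  · rw [outcomeProj_ancWires, Matrix.diagonal_mul, fanoutOp_mul_ancIsometry_apply,
      correctionLayer_apply, Equiv.symm_apply_apply, if_pos rfl, if_pos rfl, one_mul,
      Matrix.smul_apply, controlledU_eq, Matrix.diagonal_apply, smul_eq_mul]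
    by_cases h1 : x.1 = z <;> by_cases h2 : x.2 = 0 <;>
      simp [h1, h2, correctionPhase_mul_fanoutAmp]
  · rintro ⟨z', w⟩ _ hne
    rw [outcomeProj_ancWires, Matrix.diagonal_mul, fanoutOp_mul_ancIsometry_apply,
      Equiv.symm_apply_apply]
    by_cases h1 : z' = z
    · have h2 : w ≠ ancOutcome y := fun h => hne (by rw [h1, h])
      simp [h2]
    · simp [h1]
  · simp

/-- The modulus is d^(-2n) · d^n = d^(-n), so d^(2n) equally likely outcomes have total weight 1. -/
theorem branchScalar_mul_conj (o : Fin (n + n) → Fin (a * n + 1)) :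
    ((a * n + 1 : ℕ) : ℂ) ^ (n + n) * (branchScalar o * star (branchScalar o)) = 1 := by
  have hd : (0 : ℝ) < (a * n + 1 : ℕ) := by positivity
  have hs : ((Real.sqrt (a * n + 1 : ℕ))⁻¹) ^ (4 * n) = (((a * n + 1 : ℕ) : ℝ) ^ (n + n))⁻¹ := by
    rw [show 4 * n = 2 * (n + n) by ring, pow_mul, inv_pow, Real.sq_sqrt hd.le, inv_pow]
  have h : branchScalar o * star (branchScalar o) = ((((((a * n + 1 : ℕ) : ℝ) ^ (n + n))⁻¹ *
      ((a * n + 1 : ℕ) : ℝ) ^ n) ^ 2 : ℝ) : ℂ) := by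
    rw [Complex.star_def, Complex.mul_conj, Complex.normSq_eq_norm_sq, branchScalar, norm_mul,
      stdAddChar_apply, Circle.norm_coe, mul_one, Complex.norm_real, hs, Real.norm_eq_abs, sq_abs]
  have hr : ((a * n + 1 : ℕ) : ℝ) ^ (n + n) * ((((a * n + 1 : ℕ) : ℝ) ^ (n + n))⁻¹ *
      ((a * n + 1 : ℕ) : ℝ) ^ n) ^ 2 = 1 := by
    rw [pow_add]
    field_simp
  rw [h]
  exact_mod_cast hr

theorem fanoutCircuit_implements (a n : ℕ) : Implements (fanoutCircuit a n) (controlledU a n) := by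
  intro ρ
  have hrun : (fanoutCircuit a n).run () (withAncillas ρ) =
      ∑ y : (i : ancWires n (n + n)) → Fin (wireDim a n (n + n) i),
        ((correctionLayer (ancOutcome y)).toMatrix * (outcomeProj _ y * fanoutOp a n)) *
          withAncillas ρ *
          ((correctionLayer (ancOutcome y)).toMatrix * (outcomeProj _ y * fanoutOp a n))ᴴ := by
    simp only [fanoutCircuit, AdaptiveCircuit.run, if_true, fanoutOp,
      Matrix.conjTranspose_mul, Matrix.mul_assoc]
  have hterm : ∀ y : (i : ancWires n (n + n)) → Fin (wireDim a n (n + n) i),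
      withAncillas (r := n + n) ((branchScalar (ancOutcome y) • controlledU a n) * ρ *
        (branchScalar (ancOutcome y) • controlledU a n)ᴴ) =
      (((a * n + 1 : ℕ) : ℂ) ^ (n + n))⁻¹ •
        withAncillas (controlledU a n * ρ * (controlledU a n)ᴴ) := by
    intro y
    have hκ := eq_inv_of_mul_eq_one_right (branchScalar_mul_conj (ancOutcome y))
    rw [← hκ, Matrix.conjTranspose_smul, Matrix.smul_mul, Matrix.smul_mul, Matrix.mul_smul,
      smul_smul, withAncillas_eq, withAncillas_eq, Matrix.mul_smul, Matrix.smul_mul]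
  have hconj := fun y : (i : ancWires n (n + n)) → Fin (wireDim a n (n + n) i) =>
    (conj_withAncillas (branch_mul_ancIsometry y) ρ).trans (hterm y)
  rw [hrun]
  refine (Finset.sum_congr rfl fun y _ => hconj y).trans ?_
  -- All branches yield the same operator, so summing only counts them.
  rw [Finset.sum_const, Finset.card_univ, card_ancOutcome, ← Nat.cast_smul_eq_nsmul ℂ, smul_smul]
  have hd : ((a * n + 1 : ℕ) : ℂ) ≠ 0 := Nat.cast_ne_zero.2 (Nat.succ_ne_zero _)
  rw [Nat.cast_pow, mul_inv_cancel₀ (pow_ne_zero _ hd), one_smul]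

end Correction

/-! ### Amplitudes of Dicke states and of product states -/

section Dicke

variable {a n k : ℕ}

/-- The total level `∑ i, m i` of a basis label. -/
def level (m : Sys a n) : ℕ := ∑ i, (m i : ℕ)

/-- The amplitude of `|m⟩` in the state with all spins equally rotated, up to a common factor. -/
noncomputable def binomAmp (m : Sys a n) : ℝ := ∏ i, Real.sqrt (a.choose (m i))

theorem level_le (m : Sys a n) : level m ≤ a * n := by
  calc level m ≤ ∑ _i : Fin n, a := Finset.sum_le_sum fun i _ => Nat.lt_succ_iff.1 (m i).2
    _ = a * n := by simp [mul_comm]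

theorem onWire_spinLower_mulVec (i : Fin n) (v : Sys a n → ℂ) (m : Sys a n) :
    (onWire (dim := fun _ : Fin n => a + 1) i (spinLower a) *ᵥ v) m =
      ∑ c, spinLower a (m i) c * v (Function.update m i c) := by
  have := onWire_mul_apply (dim := fun _ : Fin n => a + 1) i (spinLower a)
    (Matrix.replicateCol Unit v) m ()
  simpa [← Matrix.replicateCol_mulVec] using this

/-- The square root of (l + 1)² (a choose l+1) = (l + 1)(a - l)(a choose l): the binomial amplitudes
turn the lowering operator into multiplication by the new level. For `l > a` both sides vanish. -/
theorem sqrt_mul_sqrt_choose (a l : ℕ) :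
    Real.sqrt (((l : ℝ) + 1) * ((a : ℝ) - l)) * Real.sqrt (a.choose l) =
      (l + 1 : ℝ) * Real.sqrt (a.choose (l + 1)) := by
  rcases le_or_gt l a with hl | hl
  · have h1 : (0 : ℝ) ≤ (a : ℝ) - l := by
      have : (l : ℝ) ≤ a := by exact_mod_cast hl
      linarith
    have h : (a.choose (l + 1) : ℝ) * (l + 1) = a.choose l * ((a : ℝ) - l) := by
      rw [← Nat.cast_sub hl]
      exact_mod_cast Nat.choose_succ_right_eq a l
    have hl0 : (0 : ℝ) ≤ (l : ℝ) + 1 := by positivity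
    rw [← Real.sqrt_mul (mul_nonneg hl0 h1), mul_assoc, mul_comm ((a : ℝ) - l), ← h]
    rw [show ((l : ℝ) + 1) * ((a.choose (l + 1) : ℝ) * (l + 1)) =
      (l + 1) ^ 2 * (a.choose (l + 1) : ℝ) by ring, Real.sqrt_mul (sq_nonneg _), Real.sqrt_sq hl0]
  · rw [Nat.choose_eq_zero_of_lt hl, Nat.choose_eq_zero_of_lt (by omega)]
    simp

/-- Lowering wire `i` multiplies the level-(k+1) amplitude by `m i`; summed over `i` this gives k +
1, the next factor of the factorial. -/
theorem lower_amp (i : Fin n) (m : Sys a n) :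
    ∑ c, spinLower a (m i) c * (if level (Function.update m i c) = k then
      (binomAmp (Function.update m i c) : ℂ) else 0) =
    ((m i : ℕ) : ℂ) * (if level m = k + 1 then (binomAmp m : ℂ) else 0) := by
  have hlev : ∀ c, level (Function.update m i c) + (m i : ℕ) = level m + c := by
    intro c
    have h1 := Finset.sum_update_of_mem (Finset.mem_univ i) (fun j => (m j : ℕ)) (c : ℕ)
    have h2 := Finset.add_sum_erase Finset.univ (fun j => (m j : ℕ)) (Finset.mem_univ i)
    have h3 : level (Function.update m i c) =
        ∑ j, Function.update (fun j => (m j : ℕ)) i (c : ℕ) j := by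
      refine Finset.sum_congr rfl fun j _ => ?_
      by_cases hj : j = i
      · subst hj; simp
      · simp [hj]
    rw [h3, h1, level, ← h2, Finset.sdiff_singleton_eq_erase]
    ring
  have hamp : ∀ c, binomAmp (Function.update m i c) = Real.sqrt (a.choose c) *
      ∏ j ∈ Finset.univ.erase i, Real.sqrt (a.choose (m j)) := by
    intro c
    rw [binomAmp, ← Finset.mul_prod_erase Finset.univ _ (Finset.mem_univ i)]
    congr 1
    · simp
    · refine Finset.prod_congr rfl fun j hj => ?_
      rw [Function.update_of_ne (Finset.ne_of_mem_erase hj)]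
  -- No transition ends in level 0; otherwise the only source is the level just below.
  rcases hm : (m i : ℕ) with _ | l
  · rw [Finset.sum_eq_zero]
    · simp
    · intro c _
      simp [spinLower, hm]
  · have hl : l < a + 1 := by
      have : (m i : ℕ) < a + 1 := (m i).2
      omega
    rw [Finset.sum_eq_single (⟨l, hl⟩ : Fin (a + 1))]
    · have hcond : level (Function.update m i ⟨l, hl⟩) = k ↔ level m = k + 1 := by
        have := hlev ⟨l, hl⟩
        simp only at this
        omega
      have hm' := hamp (m i)
      rw [Function.update_eq_self, hm] at hm'
      rw [spinLower, if_pos hm, hamp]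
      simp only [hcond]
      split_ifs
      · rw [hm', ← Complex.ofReal_mul, ← mul_assoc, sqrt_mul_sqrt_choose]
        push_cast
        ring
      · simp
    · intro c _ hc
      rw [spinLower, if_neg, zero_mul]
      rw [hm]
      intro h
      exact hc (Fin.ext (by simp only; omega))
    · simp

theorem dickeUnnormalized_apply (a n k : ℕ) (m : Sys a n) :
    dickeUnnormalized a n k m =
      (k.factorial : ℂ) * if level m = k then (binomAmp m : ℂ) else 0 := by
  induction k generalizing m with
  | zero =>
    have h : level m = 0 ↔ m = fun _ => 0 := by
      simp [level, funext_iff]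
    rw [dickeUnnormalized, pow_zero, Matrix.one_mulVec, Pi.single_apply]
    by_cases hm : m = fun _ => 0
    · subst hm; simp [level, binomAmp]
    · simp [h, hm]
  | succ k ih =>
    have h : dickeUnnormalized a n (k + 1) = totalLower a n *ᵥ dickeUnnormalized a n k := by
      rw [dickeUnnormalized, dickeUnnormalized, pow_succ', Matrix.mulVec_mulVec]
    have hv : dickeUnnormalized a n k = (k.factorial : ℂ) • fun m =>
        if level m = k then (binomAmp m : ℂ) else 0 := by
      funext m; exact ih m
    rw [h, hv, Matrix.mulVec_smul, totalLower, Matrix.sum_mulVec, Pi.smul_apply, Finset.sum_apply]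
    simp only [onWire_spinLower_mulVec, lower_amp]
    rw [← Finset.sum_mul, smul_eq_mul]
    by_cases hm : level m = k + 1
    · have : ∑ i, ((m i : ℕ) : ℂ) = (k + 1 : ℕ) := by
        rw [← hm, level]; push_cast; rfl
      rw [this, Nat.factorial_succ]
      push_cast
      ring
    · simp [hm]

/-- Generalized Vandermonde identity: compare coefficients of X^k in (1 + X)^(a n) = ((1 + X)^a)^n.
-/
theorem sum_binomAmp_sq (a n k : ℕ) :
    ∑ m : Sys a n, (if level m = k then binomAmp m else 0) ^ 2 = ((a * n).choose k : ℝ) := by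
  have hpoly : ((1 + Polynomial.X : Polynomial ℝ) ^ a) =
      ∑ c : Fin (a + 1), Polynomial.C (a.choose c : ℝ) * Polynomial.X ^ (c : ℕ) := by
    rw [Fin.sum_univ_eq_sum_range fun c =>
      Polynomial.C (a.choose c : ℝ) * (Polynomial.X : Polynomial ℝ) ^ c, add_comm, add_pow]
    refine Finset.sum_congr rfl fun c _ => ?_
    simp [mul_comm]
  have h : ((1 + Polynomial.X : Polynomial ℝ) ^ (a * n)) = ∑ m : Sys a n,
      Polynomial.C (binomAmp m ^ 2) * Polynomial.X ^ level m := by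
    rw [pow_mul, hpoly, ← Fin.prod_const, Fintype.prod_sum]
    refine Finset.sum_congr rfl fun m _ => ?_
    rw [Finset.prod_mul_distrib, Finset.prod_pow_eq_pow_sum, ← map_prod, binomAmp,
      ← Finset.prod_pow]
    simp only [Real.sq_sqrt (Nat.cast_nonneg _)]
    rfl
  have hc := congrArg (fun p => Polynomial.coeff p k) h
  simp only [Polynomial.coeff_one_add_X_pow, Polynomial.finsetSum_coeff,
    Polynomial.coeff_C_mul_X_pow] at hc
  rw [hc]
  refine Finset.sum_congr rfl fun m _ => ?_
  by_cases hm : level m = k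
  · simp [hm]
  · simp [hm, Ne.symm hm]

theorem dicke_apply (a n k : ℕ) (m : Sys a n) :
    dicke a n k m = (((Real.sqrt ((a * n).choose k))⁻¹ : ℝ) : ℂ) *
      if level m = k then (binomAmp m : ℂ) else 0 := by
  have hf : (0 : ℝ) < k.factorial := by exact_mod_cast k.factorial_pos
  have h : ∑ x, ‖dickeUnnormalized a n k x‖ ^ 2 =
      (k.factorial : ℝ) ^ 2 * ((a * n).choose k : ℝ) := by
    rw [← sum_binomAmp_sq, Finset.mul_sum]
    refine Finset.sum_congr rfl fun x _ => ?_
    rw [dickeUnnormalized_apply, norm_mul, mul_pow, Complex.norm_natCast]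
    split_ifs
    · rw [Complex.norm_real, Real.norm_eq_abs, sq_abs]
    · simp
  rw [dicke, Pi.smul_apply, h, Real.sqrt_mul (sq_nonneg _), Real.sqrt_sq hf.le,
    dickeUnnormalized_apply, smul_eq_mul, ← mul_assoc]
  congr 1
  have hf' : (k.factorial : ℂ) ≠ 0 := by exact_mod_cast hf.ne'
  push_cast
  rw [mul_inv, mul_comm (_ : ℂ)⁻¹, mul_assoc, inv_mul_cancel₀ hf', mul_one]

theorem prod_psi (p : ℝ) (m : Sys a n) :
    ∏ i, psi a p (m i) = ((Real.sqrt p ^ level m * Real.sqrt (1 - p) ^ (a * n - level m) *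
      binomAmp m : ℝ) : ℂ) := by
  have h : a * n - level m = ∑ i, (a - (m i : ℕ)) := by
    have h1 : ∑ i, (a - (m i : ℕ)) + level m = a * n := by
      rw [level, ← Finset.sum_add_distrib]
      rw [Finset.sum_congr rfl fun i _ => Nat.sub_add_cancel (Nat.lt_succ_iff.1 (m i).2)]
      simp [mul_comm]
    omega
  rw [h, level, binomAmp, ← Finset.prod_pow_eq_pow_sum, ← Finset.prod_pow_eq_pow_sum,
    ← Finset.prod_mul_distrib, ← Finset.prod_mul_distrib, Complex.ofReal_prod]
  rfl

theorem sum_psi_sq {p : ℝ} (hp0 : 0 ≤ p) (hp1 : p ≤ 1) : ∑ m, ‖psi a p m‖ ^ 2 = 1 := by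
  have h : ∀ m : Fin (a + 1), ‖psi a p m‖ ^ 2 =
      p ^ (m : ℕ) * (1 - p) ^ (a - (m : ℕ)) * (a.choose m : ℝ) := by
    intro m
    rw [psi, Complex.norm_real, Real.norm_eq_abs, sq_abs, mul_pow, mul_pow, ← pow_mul, ← pow_mul,
      mul_comm _ 2, mul_comm _ 2, pow_mul, pow_mul, Real.sq_sqrt hp0, Real.sq_sqrt (by linarith),
      Real.sq_sqrt (Nat.cast_nonneg _)]
  simp only [h]
  rw [Fin.sum_univ_eq_sum_range fun m => p ^ m * (1 - p) ^ (a - m) * (a.choose m : ℝ), ← add_pow]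
  simp

/-- Extend the unit vector to an orthonormal basis and use its vectors as columns. -/
theorem exists_unitary_first_column {d : ℕ} [NeZero d] (v : Fin d → ℂ) (hv : ∑ m, ‖v m‖ ^ 2 = 1) :
    ∃ V : Matrix.unitaryGroup (Fin d) ℂ, ∀ m, V.1 m 0 = v m := by
  -- The family is constant because only its value at 0 is prescribed.
  let w : Fin d → EuclideanSpace ℂ (Fin d) := fun _ => WithLp.toLp 2 v
  have hw : ‖WithLp.toLp 2 v‖ = 1 := by
    rw [EuclideanSpace.norm_eq]
    simp [hv]
  have ho : Orthonormal ℂ (({0} : Set (Fin d)).domRestrict w) := by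
    refine ⟨fun i => hw, fun i j hij => absurd (Subsingleton.elim i j) hij⟩
  obtain ⟨b, hb⟩ := ho.exists_orthonormalBasis_extension_of_card_eq (by simp)
  refine ⟨⟨(EuclideanSpace.basisFun (Fin d) ℂ).toBasis.toMatrix b,
    (EuclideanSpace.basisFun (Fin d) ℂ).toMatrix_orthonormalBasis_mem_unitary b⟩, fun m => ?_⟩
  simp [Module.Basis.toMatrix_apply, hb 0 rfl, w]

end Dicke

/-! ### Binomial weight at the mode and the expected waiting time -/

section Probability

/-- The Stirling sequence n!/(√(2n)(n/e)^n) decreases from its value e/√2 at n = 1. -/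
theorem factorial_le_stirling {n : ℕ} (hn : n ≠ 0) :
    (n.factorial : ℝ) ≤ Real.exp 1 * Real.sqrt n * (n / Real.exp 1) ^ n := by
  obtain ⟨m, rfl⟩ := Nat.exists_eq_succ_of_ne_zero hn
  have h : Stirling.stirlingSeq (m + 1) ≤ Stirling.stirlingSeq 1 :=
    Stirling.stirlingSeq'_antitone (Nat.zero_le m)
  rw [Stirling.stirlingSeq_one, Stirling.stirlingSeq, div_le_iff₀ (by positivity)] at h
  refine h.trans (le_of_eq ?_)
  rw [Real.sqrt_mul (by norm_num)]
  field_simp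

/-- Bound N! below and k!, (N-k)! above by Stirling: the powers cancel exactly, leaving only square
roots and the constant e². -/
theorem inv_binomial_mode_le {N k : ℕ} (hk0 : 0 < k) (hkN : k < N) :
    1 ≤ ((N.choose k : ℝ) * ((k : ℝ) / N) ^ k * (1 - (k : ℝ) / N) ^ (N - k)) *
      (Real.exp 1 ^ 2 * Real.sqrt N) := by
  obtain ⟨l, rfl⟩ := Nat.exists_eq_add_of_le hkN.le
  have hl : 0 < l := by omega
  have hkR : (0 : ℝ) < k := by exact_mod_cast hk0
  have hlR : (0 : ℝ) < l := by exact_mod_cast hl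
  have hN : (0 : ℝ) < (k : ℝ) + l := by positivity
  have h1 : 1 - (k : ℝ) / ((k + l : ℕ) : ℝ) = l / ((k + l : ℕ) : ℝ) := by
    push_cast
    field_simp
    ring
  have hch : ((k + l).choose k : ℝ) * (k.factorial * l.factorial) = (k + l).factorial := by
    have := Nat.choose_mul_factorial_mul_factorial (Nat.le_add_right k l)
    rw [Nat.add_sub_cancel_left] at this
    rw [← mul_assoc]
    exact_mod_cast this
  have hfk := factorial_le_stirling hk0.ne'
  have hfl := factorial_le_stirling hl.ne'
  have hfN := Stirling.le_factorial_stirling (k + l)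
  have he : 0 < Real.exp 1 := Real.exp_pos 1
  rw [Nat.add_sub_cancel_left, h1]
  have hfact : (0 : ℝ) < k.factorial * l.factorial := by positivity
  have hprod : (k.factorial * l.factorial : ℝ) ≤ (Real.exp 1 * Real.sqrt k * (k / Real.exp 1) ^ k) *
      (Real.exp 1 * Real.sqrt l * (l / Real.exp 1) ^ l) :=
    mul_le_mul hfk hfl (by positivity) (by positivity)
  -- Crude but sufficient: k ≤ 2πN and l ≤ N.
  have hsq : Real.sqrt k * Real.sqrt l ≤
      Real.sqrt (2 * Real.pi * (k + l : ℕ)) * Real.sqrt (k + l : ℕ) := by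
    refine mul_le_mul (Real.sqrt_le_sqrt ?_) (Real.sqrt_le_sqrt ?_) (by positivity) (by positivity)
    · push_cast
      nlinarith [Real.pi_gt_three]
    · push_cast
      linarith
  have hpow : ((k : ℝ) / (k + l : ℕ)) ^ k * ((l : ℝ) / (k + l : ℕ)) ^ l *
      ((k + l : ℕ) / Real.exp 1) ^ (k + l) = (k / Real.exp 1) ^ k * (l / Real.exp 1) ^ l := by
    rw [pow_add ((k + l : ℕ) / Real.exp 1), mul_mul_mul_comm, ← mul_pow, ← mul_pow]
    congr 2 <;> (push_cast; field_simp)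
  set A := ((k : ℝ) / (k + l : ℕ)) ^ k * ((l : ℝ) / (k + l : ℕ)) ^ l with hA
  have hA0 : 0 ≤ A := by positivity
  have hmain : (k.factorial * l.factorial : ℝ) ≤
      (k + l).factorial * A * (Real.exp 1 ^ 2 * Real.sqrt (k + l : ℕ)) := by
    calc (k.factorial * l.factorial : ℝ)
        ≤ (Real.exp 1 * Real.sqrt k * (k / Real.exp 1) ^ k) *
          (Real.exp 1 * Real.sqrt l * (l / Real.exp 1) ^ l) := hprod
      _ = Real.exp 1 ^ 2 * ((k / Real.exp 1) ^ k * (l / Real.exp 1) ^ l) *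
          (Real.sqrt k * Real.sqrt l) := by ring
      _ ≤ Real.exp 1 ^ 2 * ((k / Real.exp 1) ^ k * (l / Real.exp 1) ^ l) *
          (Real.sqrt (2 * Real.pi * (k + l : ℕ)) * Real.sqrt (k + l : ℕ)) := by gcongr
      _ = (Real.sqrt (2 * Real.pi * (k + l : ℕ)) * ((k + l : ℕ) / Real.exp 1) ^ (k + l)) * A *
          (Real.exp 1 ^ 2 * Real.sqrt (k + l : ℕ)) := by rw [← hpow]; ring
      _ ≤ _ := by gcongr
  refine le_of_mul_le_mul_right ?_ hfact
  rw [one_mul]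
  refine hmain.trans (le_of_eq ?_)
  rw [← hch, hA]
  ring

/-- The probability of `k` successes in `N` trials with success probability `k / N`. -/
noncomputable def modeProb (N k : ℕ) : ℝ :=
  (N.choose k : ℝ) * ((k : ℝ) / N) ^ k * (1 - (k : ℝ) / N) ^ (N - k)

/-- At k = 0 and k = N the weight is 1 (with 0^0 = 1); these cases are separate because the upper
Stirling bound fails for 0!. -/
theorem one_le_modeProb_mul {N k : ℕ} (hN : 0 < N) (hk : k ≤ N) :
    1 ≤ modeProb N k * (Real.exp 1 ^ 2 * Real.sqrt N) := by
  have h1 : 1 ≤ Real.exp 1 ^ 2 * Real.sqrt N :=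
    one_le_mul_of_one_le_of_one_le (one_le_pow₀ (Real.one_le_exp zero_le_one))
      (Real.one_le_sqrt.2 (by exact_mod_cast hN))
  have hNR : (N : ℝ) ≠ 0 := by exact_mod_cast hN.ne'
  rcases Nat.eq_zero_or_pos k with rfl | hk0
  · simpa [modeProb] using h1
  rcases hk.eq_or_lt with rfl | hkN
  · simpa [modeProb, hNR] using h1
  exact inv_binomial_mode_le hk0 hkN

theorem modeProb_le_one {N k : ℕ} (hk : k ≤ N) : modeProb N k ≤ 1 := by
  have hp : (k : ℝ) / N ≤ 1 := div_le_one_of_le₀ (by exact_mod_cast hk) (Nat.cast_nonneg _)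
  have hp0 : (0 : ℝ) ≤ (k : ℝ) / N := by positivity
  have hq : (0 : ℝ) ≤ 1 - (k : ℝ) / N := by linarith
  have h := add_pow ((k : ℝ) / N) (1 - (k : ℝ) / N) N
  rw [add_sub_cancel, one_pow] at h
  rw [h, modeProb]
  refine le_trans (le_of_eq ?_) (Finset.single_le_sum (f := fun m =>
    ((k : ℝ) / N) ^ m * (1 - (k : ℝ) / N) ^ (N - m) * (N.choose m : ℝ)) (fun m _ => by positivity)
    (Finset.mem_range.2 (Nat.lt_succ_of_le hk)))
  ring

theorem expectedRepetitions_le {q B : ℝ} (hq0 : 0 < q) (hq1 : q ≤ 1) (h : 1 ≤ q * B) :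
    expectedRepetitions q ≤ ENNReal.ofReal B := by
  have h0 : 0 ≤ 1 - q := by linarith
  have hlt : 1 - q < 1 := by linarith
  rw [expectedRepetitions, ← ENNReal.ofReal_tsum_of_nonneg (fun t => pow_nonneg h0 t)
    (summable_geometric_of_lt_one h0 hlt), tsum_geometric_of_lt_one h0 hlt]
  refine ENNReal.ofReal_le_ofReal ?_
  rw [sub_sub_cancel, inv_le_iff_one_le_mul₀ hq0, mul_comm]
  exact h

end Probability

/-! ### Analysis of the Hadamard test -/

section Test

open ZMod

variable {a n r k : ℕ}

theorem mul_proj_mul {X : Type} [Fintype X] (M : Matrix X X ℂ) (v : X → ℂ) :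
    M * proj v * Mᴴ = proj (M *ᵥ v) := by
  rw [proj, proj, Matrix.mul_vecMulVec, Matrix.vecMulVec_mul, Matrix.star_mulVec]

/-- The state of the system and the control before the control is measured. -/
noncomputable def testKet (V : Matrix (Fin (a + 1)) (Fin (a + 1)) ℂ) :
    Sys a n × Fin (a * n + 1) → ℂ :=
  sideOp 1 (star (hadamardU (a * n + 1))).1 *ᵥ (controlledU a n *ᵥ
    (sideOp V (hadamardU (a * n + 1)).1 *ᵥ ketWith (Pi.single (fun _ => 0) 1) 0))

/-- Orthogonality of characters: the control sum of χ(c'(level m - c)) is d or 0, and d cancels the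
two factors d^(-1/2). -/
theorem testKet_apply (V : Matrix (Fin (a + 1)) (Fin (a + 1)) ℂ) (m : Sys a n)
    (c : Fin (a * n + 1)) :
    testKet V (m, c) = if (c : ℕ) = level m then ∏ i, V (m i) 0 else 0 := by
  have hd : ((a * n + 1 : ℕ) : ℂ) ≠ 0 := Nat.cast_ne_zero.2 (Nat.succ_ne_zero _)
  have hket : (ketWith (Pi.single (fun _ => 0) 1) 0 : Sys a n × Fin (a * n + 1) → ℂ) =
      Pi.single (fun _ => 0, 0) 1 := by
    funext z
    simp only [ketWith, Pi.single_apply, Prod.ext_iff]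
    by_cases h1 : z.1 = fun _ => 0 <;> by_cases h2 : z.2 = 0 <;> simp [h1, h2]
  have hlev : ∑ i, ((m i : ℕ) : ZMod (a * n + 1)) = ((level m : ℕ) : ZMod (a * n + 1)) := by
    simp [level]
  have h1 : ∀ m' c', (controlledU a n *ᵥ (sideOp V (hadamardU (a * n + 1)).1 *ᵥ
      ketWith (Pi.single (fun _ => 0) 1) 0)) (m', c') =
      stdAddChar (toZMod c' * ∑ i, ((m' i : ℕ) : ZMod (a * n + 1))) *
        ((∏ i, V (m' i) 0) * ((Real.sqrt (a * n + 1 : ℕ) : ℝ) : ℂ)⁻¹) := by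
    intro m' c'
    rw [hket, controlledU_eq, Matrix.mulVec_diagonal, Matrix.mulVec_single_one]
    have : (sideOp V (hadamardU (a * n + 1)).1).col (fun _ => 0, 0) (m', c') =
      (∏ i, V (m' i) 0) * hadamard (a * n + 1) c' 0 := rfl
    rw [this, hadamard_apply]
    simp [toZMod]
  rw [testKet, Matrix.mulVec, dotProduct, Fintype.sum_prod_type, Finset.sum_eq_single m]
  · have h2 : ∀ c', sideOp (n := n) (1 : Matrix (Fin (a + 1)) (Fin (a + 1)) ℂ)
        (star (hadamardU (a * n + 1))).1 (m, c) (m, c') =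
        ((Real.sqrt (a * n + 1 : ℕ) : ℝ) : ℂ)⁻¹ * stdAddChar (-(toZMod c' * toZMod c)) := by
      intro c'
      have : sideOp (n := n) (1 : Matrix (Fin (a + 1)) (Fin (a + 1)) ℂ)
          (star (hadamardU (a * n + 1))).1 (m, c) (m, c') =
          (∏ i, (1 : Matrix (Fin (a + 1)) (Fin (a + 1)) ℂ) (m i) (m i)) *
            star (hadamard (a * n + 1) c' c) := rfl
      rw [this, prod_one_apply, if_pos rfl, one_mul, hadamard_apply, star_mul', star_inv₀,
        Complex.star_def, Complex.conj_ofReal, AddChar.map_neg_eq_conj,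
        mul_comm (toZMod c)]
    have h3 : ∀ c', sideOp (n := n) (1 : Matrix (Fin (a + 1)) (Fin (a + 1)) ℂ)
        (star (hadamardU (a * n + 1))).1 (m, c) (m, c') * (controlledU a n *ᵥ
        (sideOp V (hadamardU (a * n + 1)).1 *ᵥ ketWith (Pi.single (fun _ => 0) 1) 0)) (m, c') =
        ((((Real.sqrt (a * n + 1 : ℕ) : ℝ) : ℂ)⁻¹) ^ 2 * ∏ i, V (m i) 0) *
          stdAddChar (toZMod c' * (((level m : ℕ) : ZMod (a * n + 1)) - toZMod c)) := by
      intro c'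
      rw [h1, h2, mul_sub, sub_eq_add_neg, AddChar.map_add_eq_mul, hlev]
      ring
    simp only [h3]
    rw [← Finset.mul_sum, sum_stdAddChar_mul, inv_pow, ← Complex.ofReal_pow,
      Real.sq_sqrt (Nat.cast_nonneg _)]
    -- Congruence modulo d is equality here, since both numbers are less than d = a n + 1.
    have hcond : ((level m : ℕ) : ZMod (a * n + 1)) - toZMod c = 0 ↔ (c : ℕ) = level m := by
      rw [sub_eq_zero, eq_comm]
      have h := (toZMod_bijective (a * n + 1)).injective.eq_iff
        (a := c) (b := ⟨level m, Nat.lt_succ_of_le (level_le m)⟩)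
      rw [Fin.ext_iff] at h
      exact h
    simp only [hcond]
    split_ifs
    · push_cast at hd ⊢
      field_simp
    · simp
  · intro m' _ hm'
    refine Finset.sum_eq_zero fun c' _ => ?_
    have : sideOp (n := n) (1 : Matrix (Fin (a + 1)) (Fin (a + 1)) ℂ)
        (star (hadamardU (a * n + 1))).1 (m, c) (m', c') =
        (∏ i, (1 : Matrix (Fin (a + 1)) (Fin (a + 1)) ℂ) (m i) (m' i)) *
          star (hadamard (a * n + 1) c' c) := rfl
    rw [this, prod_one_apply, if_neg (Ne.symm hm'), zero_mul, zero_mul]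
  · simp

/-- The values of the control correspond to the outcomes of its measurement. -/
def ctrlOutcomeEquiv (a n r : ℕ) : Fin (a * n + 1) ≃
    ((i : ({Sum.inr 0} : Finset (Fin n ⊕ Fin (r + 1)))) → Fin (wireDim a n r i)) where
  toFun c i := Fin.cast (by rw [Finset.mem_singleton.1 i.2]; rfl) c
  invFun y := y ⟨Sum.inr 0, Finset.mem_singleton_self _⟩
  left_inv _ := rfl
  right_inv y := by
    funext ⟨i, hi⟩
    obtain rfl := Finset.mem_singleton.1 hi
    rfl

theorem hadamardTest_run (V : Matrix.unitaryGroup (Fin (a + 1)) ℂ)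
    {W : AdaptiveCircuit (wireDim a n r) Unit} (hW : Implements W (controlledU a n))
    (hk : k ≤ a * n) :
    (hadamardTest V W k).run true initialState =
      withAncillas (proj fun z : Sys a n × Fin (a * n + 1) =>
        if (z.2 : ℕ) = k then testKet V.1 z else 0) := by
  rw [hadamardTest, AdaptiveCircuit.run, AdaptiveCircuit.run_bind_unit, initialState,
    conj_withAncillas (sideLayer_mul_ancIsometry _ _), mul_proj_mul, hW, mul_proj_mul]
  simp only [AdaptiveCircuit.run]
  rw [conj_withAncillas (sideLayer_mul_ancIsometry _ _), mul_proj_mul]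
  simp only [conj_withAncillas (outcomeProj_ctrl_mul_ancIsometry _), mul_proj_mul]
  rw [← (ctrlOutcomeEquiv a n r).sum_comp, Finset.sum_eq_single ⟨k, Nat.lt_succ_of_le hk⟩]
  · refine (if_pos (decide_eq_true rfl)).trans ?_
    congr 2
    funext z
    rw [Matrix.mulVec_diagonal]
    change (if (z.2 : ℕ) = k then (1 : ℂ) else 0) * testKet V.1 z = _
    split_ifs <;> simp
  · intro c _ hc
    have hc' : decide ((c : ℕ) = k) = false :=
      decide_eq_false fun h => hc (Fin.ext h)
    change (if decide ((c : ℕ) = k) = true then _ else _) = _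
    rw [hc', if_neg (by simp)]
  · simp

theorem hadamardTest_run_eq {V : Matrix.unitaryGroup (Fin (a + 1)) ℂ}
    {W : AdaptiveCircuit (wireDim a n r) Unit} (hW : Implements W (controlledU a n))
    (hk : k ≤ a * n) (hV : ∀ m, V.1 m 0 = psi a ((k : ℝ) / ((a * n : ℕ) : ℝ)) m) :
    (hadamardTest V W k).run true initialState = ((modeProb (a * n) k : ℝ) : ℂ) •
      withAncillas (proj (ketWith (dicke a n k) ⟨k, Nat.lt_succ_of_le hk⟩)) := by
  set p : ℝ := (k : ℝ) / ((a * n : ℕ) : ℝ) with hp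
  have hp0 : 0 ≤ p := by positivity
  have hp1 : p ≤ 1 := div_le_one_of_le₀ (by exact_mod_cast hk) (Nat.cast_nonneg _)
  have hC : (0 : ℝ) < (a * n).choose k := by exact_mod_cast Nat.choose_pos hk
  -- The amplitude of the normalized Dicke state in the product state; its square is the success
  -- probability.
  set s : ℝ := Real.sqrt p ^ k * Real.sqrt (1 - p) ^ (a * n - k) *
    Real.sqrt ((a * n).choose k) with hs
  have hs2 : s * s = modeProb (a * n) k := by
    rw [modeProb, ← hp, hs, ← sq, mul_pow, mul_pow, ← pow_mul, ← pow_mul, mul_comm _ 2,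
      mul_comm _ 2, pow_mul, pow_mul, Real.sq_sqrt hp0, Real.sq_sqrt (by linarith),
      Real.sq_sqrt hC.le]
    ring
  have hket : (fun z : Sys a n × Fin (a * n + 1) =>
      if (z.2 : ℕ) = k then testKet V.1 z else 0) =
      (s : ℂ) • ketWith (dicke a n k) ⟨k, Nat.lt_succ_of_le hk⟩ := by
    funext z
    obtain ⟨m, c⟩ := z
    rw [testKet_apply, Pi.smul_apply, ketWith, dicke_apply, smul_eq_mul]
    simp only [hV, Fin.ext_iff]
    by_cases hc : (c : ℕ) = k
    · by_cases hm : level m = k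
      · rw [if_pos hc, if_pos (hc.trans hm.symm), if_pos hc, if_pos hm, prod_psi, hm, mul_one,
          ← Complex.ofReal_mul, ← Complex.ofReal_mul, hs]
        congr 1
        have := (Real.sqrt_pos.2 hC).ne'
        field_simp
      · have hcm : ¬ (c : ℕ) = level m := fun h => hm (h.symm.trans hc)
        simp [hcm, hm]
    · simp [hc]
  have hproj : ∀ v : Sys a n × Fin (a * n + 1) → ℂ,
      proj ((s : ℂ) • v) = ((modeProb (a * n) k : ℝ) : ℂ) • proj v := by
    intro v
    rw [proj, proj, star_smul, Complex.star_def, Complex.conj_ofReal, Matrix.smul_vecMulVec,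
      Matrix.vecMulVec_smul, smul_smul, ← Complex.ofReal_mul, hs2]
  rw [hadamardTest_run V hW hk, hket, hproj, withAncillas_eq, withAncillas_eq, Matrix.mul_smul,
    Matrix.smul_mul]

theorem trace_withAncillas
    (ρ : Matrix (Sys a n × Fin (a * n + 1)) (Sys a n × Fin (a * n + 1)) ℂ) :
    (withAncillas (r := r) ρ).trace = ρ.trace := by
  have h : (ancIsometry a n r)ᴴ * ancIsometry a n r = 1 := by
    ext z w
    rw [mul_ancIsometry_apply, Matrix.conjTranspose_apply, ancIsometry_configEquiv,
      Matrix.one_apply]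
    by_cases hzw : w = z <;> simp [hzw]
    simp [Ne.symm hzw]
  rw [withAncillas_eq, Matrix.trace_mul_comm, ← Matrix.mul_assoc, h, Matrix.one_mul]

theorem trace_proj_dicke (hk : k ≤ a * n) (c : Fin (a * n + 1)) :
    (proj (ketWith (dicke a n k) c)).trace = 1 := by
  have hC : (0 : ℝ) < (a * n).choose k := by exact_mod_cast Nat.choose_pos hk
  rw [proj, Matrix.trace_vecMulVec, dotProduct, Fintype.sum_prod_type]
  have h : ∀ m : Sys a n, ∑ c', ketWith (dicke a n k) c (m, c') *
      star (ketWith (dicke a n k) c) (m, c') =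
      ((((a * n).choose k : ℝ)⁻¹ * (if level m = k then binomAmp m else 0) ^ 2 : ℝ) : ℂ) := by
    intro m
    rw [Finset.sum_eq_single c]
    · have : ketWith (dicke a n k) c (m, c) =
          (((Real.sqrt ((a * n).choose k))⁻¹ * if level m = k then binomAmp m else 0 : ℝ) : ℂ) := by
        rw [ketWith, dicke_apply]
        by_cases hm : level m = k <;> simp [hm]
      rw [Pi.star_apply, this, Complex.star_def, Complex.conj_ofReal, ← Complex.ofReal_mul, ← sq,
        mul_pow, inv_pow, Real.sq_sqrt hC.le]
    · intro c' _ hc'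
      simp [ketWith, hc']
    · simp
  simp only [h]
  rw [← Complex.ofReal_sum, ← Finset.mul_sum, sum_binomAmp_sq, inv_mul_cancel₀ hC.ne',
    Complex.ofReal_one]

theorem hadamardTest_fanout_depth_le (V : Matrix.unitaryGroup (Fin (a + 1)) ℂ) :
    (hadamardTest V (fanoutCircuit a n) k).depth ≤ 10 := by
  simp only [hadamardTest, fanoutCircuit, AdaptiveCircuit.bind, AdaptiveCircuit.depth]
  -- Opening layer, five fan-out layers, measurement, correction, closing layer and final
  -- measurement: ten in all.
  change _ ≤ 1 + (1 + (1 + (1 + (1 + (1 + (1 + (1 + (1 + (1 + 0)))))))))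
  gcongr
  refine Finset.sup_le fun _ _ => ?_
  gcongr
  exact Finset.sup_le fun _ _ => le_rfl

end Test

end QuditDicke

theorem mainTheorem4 :
    ∃ (D A : ℕ) (C : ℝ), ∀ (twoS n k : ℕ), 1 ≤ twoS → 1 ≤ n → ∀ hk : k ≤ twoS * n,
      ∃ (r : ℕ) (V : Matrix.unitaryGroup (Fin (twoS + 1)) ℂ)
        (W : AdaptiveCircuit (wireDim twoS n r) Unit),
        r + 1 ≤ A * n ∧
        (∀ m, V.1 m 0 = psi twoS ((k : ℝ) / ((twoS * n : ℕ) : ℝ)) m) ∧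
        Implements W (controlledU twoS n) ∧
        (hadamardTest V W k).depth ≤ D ∧
        (hadamardTest V W k).acceptProb initialState =
          ((twoS * n).choose k : ℝ) * ((k : ℝ) / ((twoS * n : ℕ) : ℝ)) ^ k *
            (1 - (k : ℝ) / ((twoS * n : ℕ) : ℝ)) ^ (twoS * n - k) ∧
        0 < (hadamardTest V W k).acceptProb initialState ∧
        (hadamardTest V W k).run true initialState =
          (((hadamardTest V W k).acceptProb initialState : ℝ) : ℂ) •
            withAncillas (proj (ketWith (dicke twoS n k) ⟨k, Nat.lt_succ_of_le hk⟩)) ∧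
        expectedRepetitions ((hadamardTest V W k).acceptProb initialState) ≤
          ENNReal.ofReal (C * Real.sqrt ((twoS : ℝ) / 2 * n)) := by
  -- The control and 2n further ancillas number 2n + 1 ≤ 3n; the factor √2 converts √(2sn) into
  -- √(sn).
  refine ⟨10, 3, Real.exp 1 ^ 2 * Real.sqrt 2, fun a n k ha hn hk => ?_⟩
  have hN : 0 < a * n := Nat.mul_pos ha hn
  obtain ⟨V, hV⟩ := exists_unitary_first_column (psi a ((k : ℝ) / ((a * n : ℕ) : ℝ)))
    (sum_psi_sq (by positivity) (div_le_one_of_le₀ (by exact_mod_cast hk) (Nat.cast_nonneg _)))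
  have hrun := hadamardTest_run_eq (fanoutCircuit_implements a n) hk hV
  have hprob : (hadamardTest V (fanoutCircuit a n) k).acceptProb initialState =
      modeProb (a * n) k := by
    rw [AdaptiveCircuit.acceptProb, hrun, Matrix.trace_smul, trace_withAncillas,
      trace_proj_dicke hk, smul_eq_mul, mul_one, Complex.ofReal_re]
  have hone := one_le_modeProb_mul hN hk
  have hpos : 0 < modeProb (a * n) k :=
    pos_of_mul_pos_left (zero_lt_one.trans_le hone) (by positivity)
  refine ⟨n + n, V, fanoutCircuit a n, by omega, hV, fanoutCircuit_implements a n,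
    hadamardTest_fanout_depth_le V, hprob, hprob ▸ hpos, by rw [hprob]; exact hrun, ?_⟩
  rw [hprob]
  refine expectedRepetitions_le hpos (modeProb_le_one hk) (hone.trans (le_of_eq ?_))
  rw [mul_assoc (Real.exp 1 ^ 2), ← Real.sqrt_mul (by norm_num)]
  congr 3
  push_cast
  ring
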